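/- Let $S_\infty$ be the group of permutations $w$ of $\{1,2,3,\dots\}$ with $w_i=i$ for all but finitely many $i$, written in one-line notation $w=w_1w_2\cdots$, and let $\ell(w)=\#\{(i,j): i<j,\ w_i>w_j\}$. Let $R(w)$ be the set of reduced words of $w$: sequences $\rho=(\rho_1,\dots,\rho_{\ell(w)})$ of positive integers such that $w$ is obtained from the identity by successively interchanging the entries in positions $\rho_j$ and $\rho_j+1$ for $j=1,\dots,\ell(w)$. The Schubert polynomial of $w\in S_\infty$ is $$\mathfrak{S}_w=\sum_{\rho\in R(w)}\ \sum_{\alpha}x_{\alpha_1}\cdots x_{\alpha_{\ell(w)}},$$ where $\alpha$ runs over the weakly increasing sequences of positive integers of length $\ell(w)$ with $\alpha_j\le\rho_j$ for all $j$ and $\alpha_j<\alpha_{j+1}$ whenever $\rho_j<\rho_{j+1}$. The Stanley symmetric polynomial of $w$ in $k$ variables is $$S_w(x_1,\dots,x_k)=\sum_{\rho\in R(w)}F_{\mathrm{Des}(\rho)}(x_1,\dots,x_k),$$ where $\mathrm{Des}(\rho)$ is the composition formed by the lengths of the maximal decreasing runs of $(\rho_1,\dots,\rho_{\ell(w)})$,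 from left to right, and $F_\beta(x_1,\dots,x_k)=\sum_b x_1^{b_1}\cdots x_k^{b_k}$, summed over all $b\in\mathbb{Z}_{\ge0}^k$ such that the sequence of nonzero parts of $b$ refines $\beta$. **Corollary.** Let $0\le j\le k$ be integers and let $u,v\in S_\infty$ be such that $\mathfrak{S}_u\in\mathbb{Z}[x_1,\dots,x_j]$. Then the product $\mathfrak{S}_u\cdot S_v(x_1,\dots,x_k)$ expands with nonnegative coefficients in the Schubert basis: there are nonnegative integers $c_w$ $(w\in S_\infty)$, all but finitely many equal to $0$, such that $$\mathfrak{S}_u\cdot S_v(x_1,\dots,x_k)=\sum_{w\in S_\infty}c_w\,\mathfrak{S}_w .$$ -/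

import Mathlib

/-!
Permutations of the positive integers are modelled on `ℕ` with everything shifted down by one:
position `i` and value `i` stand for `i + 1`, the letter `i` of a word is the transposition of `i`
and `i + 1`, and `X i` is the variable `x_{i+1}`.
-/

/-- The group of permutations `w` with `w i = i` for all but finitely many `i`. -/
def FinPerm : Subgroup (Equiv.Perm ℕ) where
  carrier := {w | {i | w i ≠ i}.Finite}
  one_mem' := by simp
  mul_mem' := by
    intro a b ha hb
    refine (Set.Finite.union ha hb).subset ?_
    intro i hi
    by_contra h
    simp only [Set.mem_union, Set.mem_ofPred_eq, not_or, not_not] at h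
    exact hi (by simp [Equiv.Perm.mul_apply, h.1, h.2])
  inv_mem' := by
    intro a ha
    refine Set.Finite.subset ha ?_
    intro i hi h
    exact hi (by rw [Equiv.Perm.inv_eq_iff_eq]; exact h.symm)

/-- The simple transposition interchanging `i` and `i + 1`. -/
def simpleTransposition (i : ℕ) : Equiv.Perm ℕ := Equiv.swap i (i + 1)

/-- Pairs of positions at which the one-line notation `w 0, w 1, …` is out of order. -/
def inversions (w : Equiv.Perm ℕ) : Set (ℕ × ℕ) := {p | p.1 < p.2 ∧ w p.2 < w p.1}

/-- The length of a permutation: its number of inversions. -/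
noncomputable def permLength (w : Equiv.Perm ℕ) : ℕ := (inversions w).ncard

/-- The permutation spelled by a word. With the product of `Equiv.Perm`, multiplying on the right
by `simpleTransposition i` interchanges the entries in positions `i` and `i + 1` of the one-line
notation; so the positions given by the letters are interchanged starting with the first letter. -/
def wordPerm (ρ : List ℕ) : Equiv.Perm ℕ := (ρ.map simpleTransposition).prod

/-- `R(w)`: the words spelling `w` whose number of letters is the length of `w`. A word
`(i_k, …, i_1)` written with its first letter `i_1` on the right is the list `[i_1, …, i_k]`. -/
def reducedWords (w : Equiv.Perm ℕ) : Set (List ℕ) :=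
  {ρ | wordPerm ρ = w ∧ ρ.length = permLength w}

/-- Pairs of values occurring out of order in the one-line notation. -/
def valueInversions (w : Equiv.Perm ℕ) : Set (ℕ × ℕ) := {p | p.1 < p.2 ∧ w⁻¹ p.2 < w⁻¹ p.1}

theorem permLength_eq (w : Equiv.Perm ℕ) : permLength w = (valueInversions w).ncard := by
  have h : valueInversions w = (fun p : ℕ × ℕ => (w p.2, w p.1)) '' inversions w := by
    ext ⟨a, b⟩
    constructor
    · rintro ⟨h1, h2⟩
      exact ⟨(w⁻¹ b, w⁻¹ a), ⟨h2, by simpa using h1⟩, by simp⟩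
    · rintro ⟨⟨i, j⟩, ⟨h1, h2⟩, h3⟩
      simp only [Prod.mk.injEq] at h3
      obtain ⟨rfl, rfl⟩ := h3
      exact ⟨h2, by simpa using h1⟩
  rw [h, Set.ncard_image_of_injective]
  · rfl
  · rintro ⟨a, b⟩ ⟨c, d⟩ h
    simp only [Prod.mk.injEq, EmbeddingLike.apply_eq_iff_eq] at h
    ext <;> simp [h.1, h.2]

theorem wordPerm_concat (ρ : List ℕ) (i : ℕ) :
    wordPerm (ρ ++ [i]) = wordPerm ρ * simpleTransposition i := by
  simp [wordPerm]

theorem simpleTransposition_lt {i x y : ℕ} (h : x < y) :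
    simpleTransposition i x < simpleTransposition i y ∨ (x = i ∧ y = i + 1) := by
  simp only [simpleTransposition, Equiv.swap_apply_def]
  split_ifs <;> omega

theorem valueInversions_mul_lt (w : Equiv.Perm ℕ) (i : ℕ) (h : w i < w (i + 1)) :
    valueInversions (w * simpleTransposition i) =
      insert (w i, w (i + 1)) (valueInversions w) := by
  have hs : (simpleTransposition i)⁻¹ = simpleTransposition i := by simp [simpleTransposition]
  have hw : ∀ z, w⁻¹ (w z) = z := fun z => by simp
  ext ⟨a, b⟩
  obtain ⟨x, rfl⟩ := w.surjective a
  obtain ⟨y, rfl⟩ := w.surjective b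
  simp only [valueInversions, Set.mem_ofPred_eq, mul_inv_rev, hs, Equiv.Perm.mul_apply,
    hw, Set.mem_insert_iff, Prod.mk.injEq, EmbeddingLike.apply_eq_iff_eq]
  constructor
  · rintro ⟨h1, h2⟩
    rcases lt_trichotomy y x with h3 | h3 | h3
    · exact Or.inr ⟨h1, h3⟩
    · subst h3; omega
    · rcases simpleTransposition_lt (i := i) h3 with h4 | h4
      · omega
      · exact Or.inl h4
  · rintro (⟨rfl, rfl⟩ | ⟨h1, h2⟩)
    · exact ⟨h, by simp [simpleTransposition]⟩
    · refine ⟨h1, ?_⟩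
      rcases simpleTransposition_lt (i := i) h2 with h4 | ⟨rfl, rfl⟩
      · exact h4
      · omega

theorem valueInversions_mul_gt (w : Equiv.Perm ℕ) (i : ℕ) (h : w (i + 1) < w i) :
    valueInversions (w * simpleTransposition i) ⊆ valueInversions w := by
  have h1 := valueInversions_mul_lt (w * simpleTransposition i) i
    (by simpa [simpleTransposition] using h)
  have h2 : w * simpleTransposition i * simpleTransposition i = w := by
    simp [mul_assoc, simpleTransposition]
  rw [h2] at h1
  rw [h1]
  exact Set.subset_insert _ _

theorem valueInversions_wordPerm (ρ : List ℕ) :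
    (valueInversions (wordPerm ρ)).Finite ∧
      (valueInversions (wordPerm ρ)).ncard ≤ ρ.length := by
  induction ρ using List.reverseRecOn with
  | nil =>
    have : valueInversions (wordPerm []) = ∅ := by
      ext ⟨a, b⟩
      simp only [valueInversions, wordPerm, List.map_nil, List.prod_nil, inv_one,
        Equiv.Perm.one_apply, Set.mem_ofPred_eq, Set.mem_empty_iff_false, iff_false]
      omega
    simp [this]
  | append_singleton ρ i ih =>
    rw [wordPerm_concat]
    rcases lt_or_gt_of_ne (show wordPerm ρ i ≠ wordPerm ρ (i + 1) by simp) with h | h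
    · rw [valueInversions_mul_lt _ _ h]
      refine ⟨ih.1.insert _, (Set.ncard_insert_le _ _).trans ?_⟩
      simpa using ih.2
    · have := valueInversions_mul_gt _ _ h
      refine ⟨ih.1.subset this, (Set.ncard_le_ncard this ih.1).trans ?_⟩
      simpa using ih.2.trans (Nat.le_succ _)

theorem letters_lt (N : ℕ) (ρ : List ℕ)
    (hρ : (valueInversions (wordPerm ρ)).ncard = ρ.length)
    (hN : ∀ p ∈ valueInversions (wordPerm ρ), p.2 < N) :
    (∀ i ∈ ρ, i < N) ∧ ∀ i, N ≤ i → wordPerm ρ i = i := by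
  induction ρ using List.reverseRecOn with
  | nil => simp [wordPerm]
  | append_singleton ρ i ih =>
    have hle := valueInversions_wordPerm ρ
    rw [wordPerm_concat] at hρ hN ⊢
    rw [List.length_append, List.length_singleton] at hρ
    rcases lt_or_gt_of_ne (show wordPerm ρ i ≠ wordPerm ρ (i + 1) by simp) with h | h
    · rw [valueInversions_mul_lt _ _ h] at hρ hN
      have h1 := Set.ncard_insert_le (wordPerm ρ i, wordPerm ρ (i + 1))
        (valueInversions (wordPerm ρ))
      obtain ⟨h2, h3⟩ := ih (by omega) (fun p hp => hN p (Set.mem_insert_of_mem _ hp))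
      have h4 := hN _ (Set.mem_insert _ _)
      have h5 : i + 1 < N := by
        by_contra hc
        rw [h3 (i + 1) (by omega)] at h4
        exact hc h4
      refine ⟨?_, ?_⟩
      · intro j hj
        rcases List.mem_append.1 hj with hj | hj
        · exact h2 j hj
        · rw [List.mem_singleton.1 hj]; omega
      · intro j hj
        rw [Equiv.Perm.mul_apply, simpleTransposition,
          Equiv.swap_apply_of_ne_of_ne (by omega) (by omega), h3 j hj]
    · have := Set.ncard_le_ncard (valueInversions_mul_gt _ _ h) hle.1
      omega

theorem finite_reducedWords (w : FinPerm) : (reducedWords w).Finite := by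
  obtain ⟨w, hw⟩ := w
  obtain ⟨M, hM⟩ := Set.Finite.bddAbove (show {i | w i ≠ i}.Finite from hw)
  have hfix : ∀ i, M + 1 ≤ i → w⁻¹ i = i := by
    intro i hi
    rw [Equiv.Perm.inv_eq_iff_eq]
    by_contra hc
    have := hM (show i ∈ {i | w i ≠ i} from fun h => hc h.symm)
    omega
  have hval : ∀ p ∈ valueInversions w, p.2 < M + 1 := by
    rintro ⟨a, b⟩ ⟨h1, h2⟩
    by_contra hc
    simp only [not_lt] at h1 h2 hc
    rw [hfix b hc] at h2
    have h3 : w (w⁻¹ a) = a := by simp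
    have h4 := hfix (w⁻¹ a) (by omega)
    have h5 : w⁻¹ a = a := w⁻¹.injective h4
    omega
  refine Set.Finite.subset
    (Set.Finite.image (List.map Fin.val) (List.finite_length_eq (Fin (M + 1)) (permLength w))) ?_
  rintro ρ ⟨h1, h2⟩
  have h3 := (letters_lt (M + 1) ρ (by rw [h1, ← permLength_eq, h2]) (by rw [h1]; exact hval)).1
  refine ⟨ρ.pmap (fun i hi => ⟨i, hi⟩) h3, by simpa using h2, ?_⟩
  simp [List.map_pmap]

/-- The finite set of reduced words of a finitely supported permutation. -/
noncomputable def reducedWordFinset (w : FinPerm) : Finset (List ℕ) :=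
  (finite_reducedWords w).toFinset

open Classical in
/-- The compatible sequences of a word `ρ`: weakly increasing sequences `α` with as many terms as
`ρ`, such that `α_j ≤ ρ_j`, and `α_j < α_{j+1}` whenever `ρ_j < ρ_{j+1}`. -/
noncomputable def compatibleSequences (ρ : List ℕ) : Finset (Fin ρ.length → ℕ) :=
  (Fintype.piFinset fun j : Fin ρ.length => Finset.range (ρ.get j + 1)).filter fun α =>
    Monotone α ∧
      ∀ i j : Fin ρ.length, (j : ℕ) = (i : ℕ) + 1 → ρ.get i < ρ.get j → α i < α j

/-- The Schubert polynomial of `w`. -/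
noncomputable def schubert (w : FinPerm) : MvPolynomial ℕ ℤ :=
  ∑ ρ ∈ reducedWordFinset w, ∑ α ∈ compatibleSequences ρ, ∏ j, MvPolynomial.X (α j)

/-- The strong composition obtained from a weak composition by removing the zero parts. -/
def flat {k : ℕ} (b : Fin k → ℕ) : List ℕ := (List.ofFn b).filter (· ≠ 0)

/-- `β` refines `α`: the parts of `β`, grouped into consecutive blocks, sum to the parts of `α`. -/
def Refines (β α : List ℕ) : Prop := ∃ L : List (List ℕ), L.flatten = β ∧ L.map List.sum = α

open Classical in
/-- The fundamental quasisymmetric polynomial of the composition `α` in `k` variables: the sum of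
`x^b` over the weak compositions `b` of length `k` such that `flat b` refines `α`. -/
noncomputable def fundamental (k : ℕ) (α : List ℕ) : MvPolynomial ℕ ℤ :=
  ∑ b ∈ (Finset.finAntidiagonal k α.sum).filter (fun b => Refines (flat b) α),
    ∏ i : Fin k, MvPolynomial.X (i : ℕ) ^ b i

/-- The strong descent composition of a word: the lengths of the runs `ρ^(1), ρ^(2), …`. In the
written form `(i_k, …, i_1)` the runs are the maximal increasing factors, numbered from the right;
in the list `[i_1, …, i_k]` they are the maximal decreasing factors, numbered from the left. -/
def descentComposition (ρ : List ℕ) : List ℕ :=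
  (ρ.splitBy fun a b => decide (b < a)).map List.length

/-- The Stanley symmetric polynomial of `w` in `k` variables. -/
noncomputable def stanley (k : ℕ) (w : FinPerm) : MvPolynomial ℕ ℤ :=
  ∑ ρ ∈ reducedWordFinset w, fundamental k (descentComposition ρ)

/-! Let u × v act as u on the first n positions and as v, shifted by n, on the others, where n ≥ k
and u fixes every position from n on. The product in question is the Schubert polynomial of u × v
with all variables after the k-th set to zero, and every Schubert polynomial truncated in this way
is Schubert-positive.

Everything is read off lists of boxes (a, i). The coefficient at w of the ordered product of
nilCoxeter factors 1 + x_a u_i is `boxGen`; it sums over the sublists whose letters form a reduced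
word of w. The staircase a ≤ i gives Schubert polynomials (`schubert_eq_boxGen`), the full grid
gives Stanley polynomials (`stanley_eq_boxGen`), and keeping only the rows a < k is the truncation.
At a direct sum the coefficient factors into the letters below n and the letters from n on
(`boxGen_directSum`). As k ≤ n, the condition a ≤ i is void for the latter, so they form a grid and
contribute the Stanley polynomial; the former contribute 𝔖_u, which involves no truncated variable.

For positivity, Monk's rule writes x_r 𝔖_v as a sum over covers exchanging r with a later position
minus a sum over covers exchanging r with an earlier one. After truncation the left side vanishes
for r ≥ k (`monkOp_boxGen_boxStaircase_mem`; its proof moves `monkOp` past the box factors by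
nil-Hecke commutation relations). For a suitable v this is the Lascoux–Schützenberger transition
without its monomial term, a subtraction-free recursion (`mem_of_transition`). It ends at
permutations increasing from position k on, whose Schubert polynomials are unaffected by truncation.
-/

/-! ### Operators on functions of permutations -/

section Operators

variable {R : Type*} [CommRing R]

/-- Right multiplication by a nilCoxeter generator. -/
def descentOp (R : Type*) [CommRing R] (i : ℕ) : Module.End R (Equiv.Perm ℕ → R) where
  toFun f w := if w (i + 1) < w i then f (w * simpleTransposition i) else 0
  map_add' f g := by ext w; simp only [Pi.add_apply]; split_ifs <;> simp
  map_smul' c f := by ext w; simp only [Pi.smul_apply, RingHom.id_apply]; split_ifs <;> simp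

theorem descentOp_apply (i : ℕ) (f : Equiv.Perm ℕ → R) (w : Equiv.Perm ℕ) :
    descentOp R i f w = if w (i + 1) < w i then f (w * simpleTransposition i) else 0 := rfl

/-- Exchanging the entries in positions `a < b` is a Bruhat cover. -/
def IsCover (w : Equiv.Perm ℕ) (a b : ℕ) : Prop :=
  a < b ∧ w a < w b ∧ ∀ c, a < c → c < b → ¬ (w a < w c ∧ w c < w b)

open Classical in
/-- Evaluation at the cover obtained by exchanging the entries in positions `a` and `b`. -/
noncomputable def coverOp (R : Type*) [CommRing R] (a b : ℕ) :
    Module.End R (Equiv.Perm ℕ → R) where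
  toFun f w := if IsCover w a b then f (w * Equiv.swap a b) else 0
  map_add' f g := by ext w; simp only [Pi.add_apply]; split_ifs <;> simp
  map_smul' c f := by ext w; simp only [Pi.smul_apply, RingHom.id_apply]; split_ifs <;> simp

open Classical in
theorem coverOp_apply (a b : ℕ) (f : Equiv.Perm ℕ → R) (w : Equiv.Perm ℕ) :
    coverOp R a b f w = if IsCover w a b then f (w * Equiv.swap a b) else 0 := rfl

theorem coverOp_of_le {a b : ℕ} (h : b ≤ a) : coverOp R a b = 0 := by
  ext f w
  rw [coverOp_apply, if_neg (fun hc => by have := hc.1; omega)]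
  rfl

theorem simpleTransposition_apply_left (i : ℕ) : simpleTransposition i i = i + 1 := by
  simp [simpleTransposition]

theorem simpleTransposition_apply_right (i : ℕ) : simpleTransposition i (i + 1) = i := by
  simp [simpleTransposition]

theorem simpleTransposition_apply_of_ne {i c : ℕ} (h : c ≠ i) (h' : c ≠ i + 1) :
    simpleTransposition i c = c := Equiv.swap_apply_of_ne_of_ne h h'

theorem simpleTransposition_mul_self (i : ℕ) :
    simpleTransposition i * simpleTransposition i = 1 := by
  simp [simpleTransposition]

theorem simpleTransposition_simpleTransposition (i c : ℕ) :
    simpleTransposition i (simpleTransposition i c) = c := by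
  simp [simpleTransposition]

theorem swap_mul_simpleTransposition (a b i : ℕ) :
    Equiv.swap a b * simpleTransposition i =
      simpleTransposition i *
        Equiv.swap (simpleTransposition i a) (simpleTransposition i b) := by
  rw [Equiv.mul_swap_eq_swap_mul, simpleTransposition_simpleTransposition,
    simpleTransposition_simpleTransposition]

/-- Lifting property: a cover by a reflection other than `s_i` is compatible with a descent. -/
theorem isCover_mul_simpleTransposition (w : Equiv.Perm ℕ) {a b i : ℕ}
    (h : ¬ (a = i ∧ b = i + 1)) (h' : ¬ (a = i + 1 ∧ b = i)) :
    (IsCover w a b ∧ (w * Equiv.swap a b) (i + 1) < (w * Equiv.swap a b) i) ↔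
      (w (i + 1) < w i ∧ IsCover (w * simpleTransposition i)
        (simpleTransposition i a) (simpleTransposition i b)) := by
  have hw : ∀ x y, w x = w y → x = y := fun x y hxy => w.injective hxy
  have hss := simpleTransposition_simpleTransposition i
  have hs1 := simpleTransposition_apply_left i
  have hs2 := simpleTransposition_apply_right i
  have hs3 : ∀ c, c ≠ i → c ≠ i + 1 → simpleTransposition i c = c :=
    fun c h h' => simpleTransposition_apply_of_ne h h'
  have hne : w i ≠ w (i + 1) := by simp
  simp only [IsCover, Equiv.Perm.mul_apply, hss]
  constructor
  · rintro ⟨⟨hab, hwab, hc⟩, hd⟩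
    have hci := hc i
    have hci' := hc (i + 1)
    refine ⟨?_, ?_, hwab, fun c => ?_⟩
    · clear hc hw hss hs1 hs2 hs3
      simp only [Equiv.swap_apply_def] at hd
      split_ifs at hd <;> subst_vars <;> grind
    · grind
    · have := hc (simpleTransposition i c)
      grind
  · rintro ⟨hd, hab, hwab, hc⟩
    have hci := hc i
    have hci' := hc (i + 1)
    refine ⟨⟨?_, hwab, fun c => ?_⟩, ?_⟩
    · grind
    · have := hc (simpleTransposition i c)
      grind
    · have e1 := hw i b
      have e2 := hw (i + 1) a
      clear hc hw hss
      simp only [Equiv.swap_apply_def]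
      split_ifs <;> subst_vars <;> grind

theorem coverOp_mul_descentOp {a b i : ℕ}
    (h : ¬ (a = i ∧ b = i + 1)) (h' : ¬ (a = i + 1 ∧ b = i)) :
    coverOp R a b * descentOp R i =
      descentOp R i * coverOp R (simpleTransposition i a) (simpleTransposition i b) := by
  classical
  ext f w
  simp only [Module.End.mul_apply, coverOp_apply, descentOp_apply]
  rw [← ite_and, ← ite_and, if_congr (isCover_mul_simpleTransposition w h h') rfl rfl,
    mul_assoc, mul_assoc, swap_mul_simpleTransposition]

/-- At each w exactly one summand survives, the first at an ascent in position i and the second at a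
descent, and it returns f w because s_i is an involution. -/
theorem coverOp_mul_descentOp_add (i : ℕ) :
    coverOp R i (i + 1) * descentOp R i + descentOp R i * coverOp R i (i + 1) = 1 := by
  classical
  ext f w
  have hne : w i ≠ w (i + 1) := by simp
  have h1 : IsCover w i (i + 1) ↔ w i < w (i + 1) :=
    ⟨fun h => h.2.1, fun h => ⟨by omega, h, fun c _ _ => by omega⟩⟩
  have h2 : IsCover (w * simpleTransposition i) i (i + 1) ↔ w (i + 1) < w i :=
    ⟨fun h => by simpa [simpleTransposition] using h.2.1,
      fun h => ⟨by omega, by simpa [simpleTransposition] using h, fun c _ _ => by omega⟩⟩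
  simp only [LinearMap.add_apply, Pi.add_apply, Module.End.mul_apply, Module.End.one_apply,
    coverOp_apply, descentOp_apply, h1, h2, Equiv.Perm.mul_apply, Equiv.swap_apply_left,
    Equiv.swap_apply_right]
  rcases lt_or_gt_of_ne hne with h | h
  · simp [h, h.not_gt, mul_assoc, simpleTransposition]
  · simp [h, h.not_gt, mul_assoc, simpleTransposition]

/-- The Monk operator at `r`, with exchanges restricted to positions at most `N`. -/
noncomputable def monkOp (R : Type*) [CommRing R] (N r : ℕ) : Module.End R (Equiv.Perm ℕ → R) :=
  -- Position N is included so that every s_i with i < N permutes the index set.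
  ∑ b ∈ Finset.range (N + 1), (coverOp R r b - coverOp R b r)

theorem monkOp_aux {N i r : ℕ} (hi : i < N) :
    ∑ b ∈ Finset.range (N + 1), (coverOp R (simpleTransposition i r) (simpleTransposition i b) -
      coverOp R (simpleTransposition i b) (simpleTransposition i r)) =
      monkOp R N (simpleTransposition i r) := by
  refine Finset.sum_nbij' (simpleTransposition i) (simpleTransposition i) ?_ ?_ ?_ ?_ ?_
  · intro b hb
    simp only [Finset.mem_range, simpleTransposition, Equiv.swap_apply_def] at hb ⊢
    split_ifs <;> omega
  · intro b hb
    simp only [Finset.mem_range, simpleTransposition, Equiv.swap_apply_def] at hb ⊢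
    split_ifs <;> omega
  · intro b _; exact simpleTransposition_simpleTransposition i b
  · intro b _; exact simpleTransposition_simpleTransposition i b
  · intro b _; rfl

theorem monkOp_mul_descentOp_of_ne {N i r : ℕ} (hi : i < N) (h : r ≠ i) (h' : r ≠ i + 1) :
    monkOp R N r * descentOp R i = descentOp R i * monkOp R N r := by
  have := monkOp_aux (R := R) (r := r) hi
  rw [simpleTransposition_apply_of_ne h h'] at this
  conv_rhs => rw [← this]
  rw [monkOp, Finset.sum_mul, Finset.mul_sum]
  refine Finset.sum_congr rfl fun b _ => ?_
  rw [sub_mul, mul_sub, coverOp_mul_descentOp (by omega) (by omega),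
    coverOp_mul_descentOp (by omega) (by omega), simpleTransposition_apply_of_ne h h']

/-- The operators `monkOp` behave towards `descentOp` as the variables do towards divided
differences. The constant 1 comes from the single exchange b = i + 1, through
`coverOp_mul_descentOp_add`; the other terms are only reindexed. -/
theorem monkOp_mul_descentOp_left {N i : ℕ} (hi : i < N) :
    monkOp R N i * descentOp R i = descentOp R i * monkOp R N (i + 1) + 1 := by
  have := monkOp_aux (R := R) (r := i) hi
  rw [simpleTransposition_apply_left] at this
  have hm : i + 1 ∈ Finset.range (N + 1) := by simpa using hi
  rw [← this, monkOp, Finset.sum_mul, Finset.mul_sum, ← Finset.add_sum_erase _ _ hm,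
    ← Finset.add_sum_erase _ _ hm, simpleTransposition_apply_right,
    coverOp_of_le (a := i + 1) (b := i) (by omega), ← coverOp_mul_descentOp_add i,
    Finset.sum_congr rfl (g := fun b => descentOp R i * (coverOp R (i + 1)
      (simpleTransposition i b) - coverOp R (simpleTransposition i b) (i + 1)))]
  · rw [sub_zero, mul_sub _ 0, mul_zero, zero_sub]
    abel
  · intro b hb
    have := Finset.ne_of_mem_erase hb
    rw [sub_mul, mul_sub, coverOp_mul_descentOp (by omega) (by omega),
      coverOp_mul_descentOp (by omega) (by omega), simpleTransposition_apply_left]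

theorem monkOp_mul_descentOp_right {N i : ℕ} (hi : i < N) :
    monkOp R N (i + 1) * descentOp R i = descentOp R i * monkOp R N i - 1 := by
  have := monkOp_aux (R := R) (r := i + 1) hi
  rw [simpleTransposition_apply_right] at this
  have hm : i ∈ Finset.range (N + 1) := by simp; omega
  rw [← this, monkOp, Finset.sum_mul, Finset.mul_sum, ← Finset.add_sum_erase _ _ hm,
    ← Finset.add_sum_erase _ _ hm, simpleTransposition_apply_left,
    coverOp_of_le (a := i + 1) (b := i) (by omega), ← coverOp_mul_descentOp_add i,
    Finset.sum_congr rfl (g := fun b => descentOp R i * (coverOp R i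
      (simpleTransposition i b) - coverOp R (simpleTransposition i b) i))]
  · rw [sub_zero, sub_mul 0, zero_mul, zero_sub]
    abel
  · intro b hb
    have := Finset.ne_of_mem_erase hb
    rw [sub_mul, mul_sub, coverOp_mul_descentOp (by omega) (by omega),
      coverOp_mul_descentOp (by omega) (by omega), simpleTransposition_apply_right]

end Operators

/-! ### Generating functions of lists of boxes -/

section GeneratingFunctions

variable {R : Type*} [CommRing R]

/-- The contribution of a box `(a, i)`: the operator `1 + x_a u_i`. -/
def boxOp (x : ℕ → R) (p : ℕ × ℕ) : Module.End R (Equiv.Perm ℕ → R) :=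
  1 + x p.1 • descentOp R p.2

theorem boxOp_apply (x : ℕ → R) (p : ℕ × ℕ) (f : Equiv.Perm ℕ → R) :
    boxOp x p f = f + x p.1 • descentOp R p.2 f := rfl

/-- The box operators of a list, applied from the first box to the last. -/
def applyBoxes (x : ℕ → R) (L : List (ℕ × ℕ)) (f : Equiv.Perm ℕ → R) : Equiv.Perm ℕ → R :=
  L.foldl (fun g p => boxOp x p g) f

@[simp]
theorem applyBoxes_nil (x : ℕ → R) (f : Equiv.Perm ℕ → R) : applyBoxes x [] f = f := rfl

theorem applyBoxes_append (x : ℕ → R) (L L' : List (ℕ × ℕ)) (f : Equiv.Perm ℕ → R) :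
    applyBoxes x (L ++ L') f = applyBoxes x L' (applyBoxes x L f) := by
  simp [applyBoxes]

theorem applyBoxes_concat (x : ℕ → R) (L : List (ℕ × ℕ)) (p : ℕ × ℕ) (f : Equiv.Perm ℕ → R) :
    applyBoxes x (L ++ [p]) f = boxOp x p (applyBoxes x L f) := by
  simp [applyBoxes]

open Classical in
/-- The generating function of the reduced subwords of a list of boxes. -/
noncomputable def boxGen (x : ℕ → R) (L : List (ℕ × ℕ)) : Equiv.Perm ℕ → R :=
  applyBoxes x L (Pi.single 1 1)

theorem boxGen_concat (x : ℕ → R) (L : List (ℕ × ℕ)) (p : ℕ × ℕ) :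
    boxGen x (L ++ [p]) = boxOp x p (boxGen x L) := applyBoxes_concat x L p _

theorem boxGen_concat_apply (x : ℕ → R) (L : List (ℕ × ℕ)) (p : ℕ × ℕ) (w : Equiv.Perm ℕ) :
    boxGen x (L ++ [p]) w = boxGen x L w +
      if w (p.2 + 1) < w p.2 then x p.1 * boxGen x L (w * simpleTransposition p.2) else 0 := by
  rw [boxGen_concat, boxOp_apply, Pi.add_apply, Pi.smul_apply, descentOp_apply, smul_eq_mul,
    mul_ite, mul_zero]

/-- The boxes `(a, N - 1), …, (a, r)`. -/
def boxRow (a r N : ℕ) : List (ℕ × ℕ) := ((List.range' r (N - r)).reverse).map (Prod.mk a)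

theorem boxRow_of_le {a r N : ℕ} (h : N ≤ r) : boxRow a r N = [] := by
  simp [boxRow, Nat.sub_eq_zero_of_le h]

theorem boxRow_of_lt {a r N : ℕ} (h : r < N) :
    boxRow a r N = boxRow a (r + 1) N ++ [(a, r)] := by
  obtain ⟨m, rfl⟩ := Nat.exists_eq_add_of_lt h
  rw [boxRow, boxRow, show r + m + 1 - r = m + 1 by omega,
    show r + m + 1 - (r + 1) = m by omega, List.range'_succ]
  simp

theorem mem_boxRow {a r N : ℕ} {p : ℕ × ℕ} : p ∈ boxRow a r N ↔ p.1 = a ∧ r ≤ p.2 ∧ p.2 < N := by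
  obtain ⟨b, i⟩ := p
  simp only [boxRow, List.mem_map, List.mem_reverse, List.mem_range'_1, Prod.mk.injEq]
  constructor
  · rintro ⟨c, hc, rfl, rfl⟩; exact ⟨rfl, by omega⟩
  · rintro ⟨rfl, h⟩; exact ⟨i, by omega, rfl, rfl⟩

/-- The boxes `(a, i)` with `a < k` and `a ≤ i < N`. -/
def boxStaircase : ℕ → ℕ → List (ℕ × ℕ)
  | 0, _ => []
  | k + 1, N => boxStaircase k N ++ boxRow k k N

/-- The boxes `(a, i)` with `a < k` and `i < N`. -/
def boxGrid : ℕ → ℕ → List (ℕ × ℕ)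
  | 0, _ => []
  | k + 1, N => boxGrid k N ++ boxRow k 0 N

theorem mem_boxStaircase {k N : ℕ} {p : ℕ × ℕ} :
    p ∈ boxStaircase k N ↔ p.1 < k ∧ p.1 ≤ p.2 ∧ p.2 < N := by
  induction k with
  | zero => simp [boxStaircase]
  | succ k ih => rw [boxStaircase, List.mem_append, ih, mem_boxRow]; omega

theorem mem_boxGrid {k N : ℕ} {p : ℕ × ℕ} :
    p ∈ boxGrid k N ↔ p.1 < k ∧ p.2 < N := by
  induction k with
  | zero => simp [boxGrid]
  | succ k ih => rw [boxGrid, List.mem_append, ih, mem_boxRow]; omega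

/-! ### Vanishing of Monk operators -/

/-- The functions vanishing at the permutations that fix every `i ≥ N`. -/
def vanishing (R : Type*) [CommRing R] (N : ℕ) : Submodule R (Equiv.Perm ℕ → R) where
  carrier := {f | ∀ w : Equiv.Perm ℕ, (∀ i, N ≤ i → w i = i) → f w = 0}
  zero_mem' := by intro w _; rfl
  add_mem' := by
    intro f g hf hg w hw
    rw [Pi.add_apply, hf w hw, hg w hw, add_zero]
  smul_mem' := by
    intro c f hf w hw
    rw [Pi.smul_apply, hf w hw, smul_zero]

theorem lt_of_fixes {N : ℕ} {w : Equiv.Perm ℕ} (hw : ∀ i, N ≤ i → w i = i) {i : ℕ} (hi : i < N) :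
    w i < N := by
  by_contra h
  have := w.injective (hw (w i) (by omega))
  omega

theorem descent_lt_of_fixes {N : ℕ} {w : Equiv.Perm ℕ} (hw : ∀ i, N ≤ i → w i = i) {i : ℕ}
    (hi : w (i + 1) < w i) : i + 1 < N := by
  by_contra h
  have h1 := hw (i + 1) (by omega)
  rcases Nat.lt_or_ge i N with h2 | h2
  · have := lt_of_fixes hw h2; omega
  · have := hw i h2; omega

theorem descentOp_mem_vanishing {N i : ℕ} {f : Equiv.Perm ℕ → R} (h : f ∈ vanishing R N) :
    descentOp R i f ∈ vanishing R N := by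
  intro w hw
  rw [descentOp_apply]
  split_ifs with hd
  · have := descent_lt_of_fixes hw hd
    refine h _ fun j hj => ?_
    rw [Equiv.Perm.mul_apply, simpleTransposition_apply_of_ne (by omega) (by omega), hw j hj]
  · rfl

/-- This disposes of the boundary term with `monkOp R N N`, about which nothing is known; it is why
Monk's rule is only proved modulo `vanishing`. -/
theorem descentOp_last_mem_vanishing {N i : ℕ} (hi : N ≤ i + 1) (f : Equiv.Perm ℕ → R) :
    descentOp R i f ∈ vanishing R N := by
  intro w hw
  rw [descentOp_apply, if_neg]
  intro hd
  have := descent_lt_of_fixes hw hd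
  omega

theorem boxOp_mem_vanishing {N : ℕ} (x : ℕ → R) (p : ℕ × ℕ) {f : Equiv.Perm ℕ → R}
    (h : f ∈ vanishing R N) : boxOp x p f ∈ vanishing R N :=
  add_mem h (Submodule.smul_mem _ _ (descentOp_mem_vanishing h))

theorem applyBoxes_mem_vanishing {N : ℕ} (x : ℕ → R) (L : List (ℕ × ℕ)) {f : Equiv.Perm ℕ → R}
    (h : f ∈ vanishing R N) : applyBoxes x L f ∈ vanishing R N := by
  induction L using List.reverseRecOn with
  | nil => exact h
  | append_singleton L p ih => rw [applyBoxes_concat]; exact boxOp_mem_vanishing x p ih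

theorem monkOp_boxOp_of_ne {N r : ℕ} (x : ℕ → R) (p : ℕ × ℕ) (hp : p.2 < N) (h : r ≠ p.2)
    (h' : r ≠ p.2 + 1) (f : Equiv.Perm ℕ → R) :
    monkOp R N r (boxOp x p f) = boxOp x p (monkOp R N r f) := by
  have := LinearMap.congr_fun (monkOp_mul_descentOp_of_ne (R := R) hp h h') f
  simp only [Module.End.mul_apply] at this
  rw [boxOp_apply, boxOp_apply, map_add, map_smul, this]

theorem monkOp_boxOp_left {N : ℕ} (x : ℕ → R) (p : ℕ × ℕ) (hp : p.2 < N)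
    (f : Equiv.Perm ℕ → R) :
    monkOp R N p.2 (boxOp x p f) =
      monkOp R N p.2 f + x p.1 • (descentOp R p.2 (monkOp R N (p.2 + 1) f) + f) := by
  have := LinearMap.congr_fun (monkOp_mul_descentOp_left (R := R) hp) f
  simp only [Module.End.mul_apply, LinearMap.add_apply, Module.End.one_apply] at this
  rw [boxOp_apply, map_add, map_smul, this]

theorem monkOp_boxOp_right {N : ℕ} (x : ℕ → R) (p : ℕ × ℕ) (hp : p.2 < N)
    (f : Equiv.Perm ℕ → R) :
    monkOp R N (p.2 + 1) (boxOp x p f) =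
      monkOp R N (p.2 + 1) f + x p.1 • (descentOp R p.2 (monkOp R N p.2 f) - f) := by
  have := LinearMap.congr_fun (monkOp_mul_descentOp_right (R := R) hp) f
  simp only [Module.End.mul_apply, LinearMap.sub_apply, Module.End.one_apply] at this
  rw [boxOp_apply, map_add, map_smul, this]

theorem monkOp_applyBoxes_boxRow_of_lt {N r s : ℕ} (x : ℕ → R) (a : ℕ) (h : r < s)
    (f : Equiv.Perm ℕ → R) :
    monkOp R N r (applyBoxes x (boxRow a s N) f) =
      applyBoxes x (boxRow a s N) (monkOp R N r f) := by
  rcases Nat.lt_or_ge s N with hs | hs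
  · have hle := hs.le
    induction hle using Nat.decreasingInduction with
    | self => omega
    | of_succ s hsN ih =>
      rw [boxRow_of_lt hs, applyBoxes_concat, applyBoxes_concat,
        monkOp_boxOp_of_ne x _ hs (by simp; omega) (by simp; omega)]
      congr 1
      rcases Nat.lt_or_ge (s + 1) N with hs' | hs'
      · exact ih (by omega) hs'
      · rw [boxRow_of_le hs']; rfl
  · rw [boxRow_of_le hs]; rfl

/-- Let g be the result of the row before its last box (a, r). Crossing that box gives M_r g + x_a
(u_r M_{r+1} g + g). Here M_r g is negligible, since M_r commutes with all earlier boxes, and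
M_{r+1} g is x_a g by downward induction; x_a (g + x_a u_r g) remains. -/
theorem monkOp_sub_applyBoxes_boxRow_mem {N r : ℕ} (x : ℕ → R) (a : ℕ) {f : Equiv.Perm ℕ → R}
    (hr : r < N) (hf : ∀ s, r ≤ s → s < N → monkOp R N s f ∈ vanishing R N) :
    monkOp R N r (applyBoxes x (boxRow a r N) f) - x a • applyBoxes x (boxRow a r N) f ∈
      vanishing R N := by
  have hle := hr.le
  induction hle using Nat.decreasingInduction with
  | self => omega
  | of_succ r hrN ih =>
    rw [boxRow_of_lt hr, applyBoxes_concat, monkOp_boxOp_left x (a, r) hr,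
      monkOp_applyBoxes_boxRow_of_lt x a (Nat.lt_succ_self r), boxOp_apply]
    set g := applyBoxes x (boxRow a (r + 1) N) f with hg
    have h1 : applyBoxes x (boxRow a (r + 1) N) (monkOp R N r f) ∈ vanishing R N :=
      applyBoxes_mem_vanishing x _ (hf r le_rfl hr)
    have h2 : descentOp R r (monkOp R N (r + 1) g - x a • g) ∈ vanishing R N := by
      rcases Nat.lt_or_ge (r + 1) N with hr' | hr'
      · exact descentOp_mem_vanishing (ih hr' fun s hs hs' => hf s (by omega) hs')
      · exact descentOp_last_mem_vanishing hr' _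
    convert add_mem h1 (Submodule.smul_mem _ (x a) h2) using 1
    simp only [map_sub, map_smul]
    module

/-- The boxes with letters at least r produce x_a g by the previous lemma, and crossing the box with
letter r - 1 subtracts the same x_a g. The boxes with smaller letters commute with the operator. -/
theorem monkOp_applyBoxes_boxRow_mem {N r s : ℕ} (x : ℕ → R) (a : ℕ) {f : Equiv.Perm ℕ → R}
    (hr : r < N) (hs : s < r) (hf : ∀ t, s ≤ t → t < N → monkOp R N t f ∈ vanishing R N) :
    monkOp R N r (applyBoxes x (boxRow a s N) f) ∈ vanishing R N := by
  obtain ⟨q, rfl⟩ : ∃ q, r = q + 1 := ⟨r - 1, by omega⟩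
  have hsq : s ≤ q := by omega
  induction hsq using Nat.decreasingInduction with
  | self =>
    rw [boxRow_of_lt (by omega), applyBoxes_concat, monkOp_boxOp_right x (a, q) (by simp; omega),
      monkOp_applyBoxes_boxRow_of_lt x a (Nat.lt_succ_self q)]
    have h1 := monkOp_sub_applyBoxes_boxRow_mem x a hr
      (fun t ht ht' => hf t (by omega) ht')
    have h2 : descentOp R q (applyBoxes x (boxRow a (q + 1) N) (monkOp R N q f)) ∈
        vanishing R N :=
      descentOp_mem_vanishing (applyBoxes_mem_vanishing x _ (hf q le_rfl (by omega)))
    convert add_mem h1 (Submodule.smul_mem _ (x a) h2) using 1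
    dsimp only
    module
  | of_succ s hsq ih =>
    rw [boxRow_of_lt (by omega), applyBoxes_concat,
      monkOp_boxOp_of_ne x _ (by simp; omega) (by simp; omega) (by simp; omega)]
    exact boxOp_mem_vanishing x _ (ih (fun t ht ht' => hf t (by omega) ht') (by omega))

theorem coverOp_single_one (a b : ℕ) [DecidableEq (Equiv.Perm ℕ)] :
    coverOp R a b (Pi.single 1 1) = 0 := by
  classical
  ext w
  rw [coverOp_apply, Pi.zero_apply]
  split_ifs with h
  · rw [Pi.single_apply, if_neg]
    intro hw
    have h1 := DFunLike.congr_fun hw a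
    have h2 := DFunLike.congr_fun hw b
    simp only [Equiv.Perm.mul_apply, Equiv.swap_apply_left, Equiv.swap_apply_right,
      Equiv.Perm.one_apply] at h1 h2
    have := h.1
    have := h.2.1
    omega
  · rfl

/-- Monk's rule for a variable that has been set to zero. With no rows it holds because the identity
covers nothing; each new row starts at a position before r and preserves it. -/
theorem monkOp_boxGen_boxStaircase_mem (x : ℕ → R) {k r N : ℕ} (hk : k ≤ r) (hr : r < N) :
    monkOp R N r (boxGen x (boxStaircase k N)) ∈ vanishing R N := by
  induction k generalizing r with
  | zero =>
    have : monkOp R N r (boxGen x (boxStaircase 0 N)) = 0 := by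
      simp [monkOp, boxGen, boxStaircase, LinearMap.sum_apply, coverOp_single_one]
    rw [this]
    exact zero_mem _
  | succ k ih =>
    rw [boxGen, boxStaircase, applyBoxes_append]
    exact monkOp_applyBoxes_boxRow_mem x k hr hk fun t ht ht' => ih ht ht'

end GeneratingFunctions

/-! ### The transition recursion -/

section Transition

variable {R : Type*} [CommRing R]

theorem lt_of_increasing_from {w : Equiv.Perm ℕ} {r : ℕ} (h : ∀ i, r ≤ i → w i < w (i + 1))
    {i j : ℕ} (hi : r ≤ i) (hij : i < j) : w i < w j := by
  induction j, hij using Nat.le_induction with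
  | base => exact h i hi
  | succ j hj ih => exact ih.trans (h j (by omega))

theorem exists_last_smaller {w : Equiv.Perm ℕ} {r N : ℕ} (hw : ∀ i, N ≤ i → w i = i) (hr : r < N)
    (hd : w (r + 1) < w r) :
    ∃ s, r < s ∧ s < N ∧ w s < w r ∧ ∀ t, s < t → w r < w t := by
  classical
  have hrN := lt_of_fixes hw hr
  have h1 := Nat.findGreatest_spec (P := fun s => w s < w r) (show r + 1 ≤ N by omega) hd
  have h2 := Nat.le_findGreatest (P := fun s => w s < w r) (show r + 1 ≤ N by omega) hd
  have h3 : ∀ t, Nat.findGreatest (fun s => w s < w r) N < t → w r < w t := by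
    intro t ht
    rcases Nat.lt_or_ge t N with h | h
    · have h4 := Nat.findGreatest_is_greatest ht h.le
      have h5 : w t ≠ w r := fun he => by have := w.injective he; omega
      omega
    · rw [hw t h]; omega
  have h4 := Nat.findGreatest_le (P := fun s => w s < w r) N
  generalize Nat.findGreatest (fun s => w s < w r) N = s at *
  refine ⟨s, by omega, ?_, h1, h3⟩
  by_contra h
  have := hw s (by omega)
  omega

/-- Let s be the last position with w s < w r and v = w t_{rs}. The only cover of v exchanging r
with a later position is w itself, so vanishing at v expresses f w as the sum of f over the covers v
t_{br} with b < r. These stay increasing after r, and their entry at r is v b < v r = w s < w r. -/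
theorem mem_of_transition {N r : ℕ} {f : Equiv.Perm ℕ → R}
    (hf : monkOp R N r f ∈ vanishing R N) (C : AddSubmonoid R) {w : Equiv.Perm ℕ}
    (hw : ∀ i, N ≤ i → w i = i) (hr : r < N) (hd : w (r + 1) < w r)
    (hinc : ∀ i, r + 1 ≤ i → w i < w (i + 1))
    (hC : ∀ w' : Equiv.Perm ℕ, (∀ i, N ≤ i → w' i = i) → (∀ i, r + 1 ≤ i → w' i < w' (i + 1)) →
      w' r < w r → f w' ∈ C) : f w ∈ C := by
  classical
  obtain ⟨s, hrs, hsN, hsr, hgt⟩ := exists_last_smaller hw hr hd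
  have hmono : ∀ {i j}, r + 1 ≤ i → i < j → w i < w j := lt_of_increasing_from hinc
  set v := w * Equiv.swap r s with hv
  have hvr : v r = w s := by simp [hv]
  have hvs : v s = w r := by simp [hv]
  have hvo : ∀ i, i ≠ r → i ≠ s → v i = w i := fun i h h' => by
    rw [hv, Equiv.Perm.mul_apply, Equiv.swap_apply_of_ne_of_ne h h']
  have hvN : ∀ i, N ≤ i → v i = i := fun i hi => by
    rw [hvo i (by omega) (by omega), hw i hi]
  -- For r < b < s the entry v b is below v r = w s; for b > s the entry v s = w r lies strictly
  -- between v r and v b.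
  have hcov : ∀ b, IsCover v r b ↔ b = s := by
    intro b
    constructor
    · rintro ⟨h1, h2, h3⟩
      rcases lt_trichotomy b s with h | h | h
      · rw [hvr, hvo b (by omega) (by omega)] at h2
        have := hmono (i := b) (by omega) h
        omega
      · exact h
      · have h4 := h3 s hrs h
        rw [hvr, hvs, hvo b (by omega) (by omega)] at h4
        exact absurd ⟨hsr, hgt b h⟩ h4
    · rintro rfl
      refine ⟨hrs, by omega, fun c h1 h2 => ?_⟩
      have := hmono (i := c) (by omega) h2
      rw [hvo c (by omega) (by omega)]
      omega
  have hzero := hf v hvN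
  have hsum : ∑ b ∈ Finset.range (N + 1), coverOp R r b f v = f w := by
    rw [Finset.sum_eq_single s]
    · rw [coverOp_apply, if_pos ((hcov s).2 rfl), hv, mul_assoc, Equiv.swap_mul_self, mul_one]
    · intro b _ hb
      rw [coverOp_apply, if_neg (fun h => hb ((hcov b).1 h))]
    · intro h
      exact absurd (Finset.mem_range.2 (by omega)) h
  have hfw : f w = ∑ b ∈ Finset.range (N + 1), coverOp R b r f v := by
    rw [← hsum, ← sub_eq_zero, ← Finset.sum_sub_distrib, ← hzero]
    simp [monkOp, LinearMap.sum_apply]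
  rw [hfw]
  refine sum_mem fun b _ => ?_
  rw [coverOp_apply]
  split_ifs with h
  · have hbr := h.1
    have hv' : ∀ i, r < i → (v * Equiv.swap b r) i = v i := fun i hi => by
      rw [Equiv.Perm.mul_apply, Equiv.swap_apply_of_ne_of_ne (by omega) (by omega)]
    refine hC _ ?_ ?_ ?_
    · intro i hi
      rw [hv' i (by omega), hvN i hi]
    · intro i hi
      rw [hv' i (by omega), hv' (i + 1) (by omega)]
      have h1 := hinc i hi
      rcases lt_trichotomy i s with h2 | h2 | h2
      · rw [hvo i (by omega) (by omega)]
        rcases eq_or_ne (i + 1) s with h3 | h3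
        · rw [h3, hvs]
          have := hmono hi h2
          omega
        · rwa [hvo (i + 1) (by omega) h3]
      · rw [h2, hvs, hvo (s + 1) (by omega) (by omega)]
        exact hgt _ (by omega)
      · rwa [hvo i (by omega) (by omega), hvo (i + 1) (by omega) (by omega)]
    · have := h.2.1
      rw [Equiv.Perm.mul_apply, Equiv.swap_apply_right]
      omega
  · exact zero_mem C

/-- Double induction: on the position from which w increases, and, for a last descent at r, on the
entry w r, which each transition lowers. -/
theorem boxGen_boxStaircase_mem (x : ℕ → R) {k N : ℕ} (hk : k ≤ N) (C : AddSubmonoid R)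
    (hC : ∀ w : Equiv.Perm ℕ, (∀ i, N ≤ i → w i = i) → (∀ i, k ≤ i → w i < w (i + 1)) →
      boxGen x (boxStaircase k N) w ∈ C) {w : Equiv.Perm ℕ} (hw : ∀ i, N ≤ i → w i = i) :
    boxGen x (boxStaircase k N) w ∈ C := by
  have key : ∀ t, k ≤ t → t ≤ N → ∀ w : Equiv.Perm ℕ, (∀ i, N ≤ i → w i = i) →
      (∀ i, t ≤ i → w i < w (i + 1)) → boxGen x (boxStaircase k N) w ∈ C := by
    intro t ht
    induction t, ht using Nat.le_induction with
    | base => exact fun _ => hC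
    | succ r hr ih =>
      intro hrN
      have inner : ∀ m, ∀ w : Equiv.Perm ℕ, w r = m → (∀ i, N ≤ i → w i = i) →
          (∀ i, r + 1 ≤ i → w i < w (i + 1)) → boxGen x (boxStaircase k N) w ∈ C := by
        intro m
        induction m using Nat.strong_induction_on with
        | _ m ihm =>
          intro w hm hw hinc
          rcases lt_or_gt_of_ne (show w r ≠ w (r + 1) by simp) with h | h
          · refine ih (by omega) w hw fun i hi => ?_
            rcases hi.eq_or_lt with rfl | hi
            · exact h
            · exact hinc i hi
          · exact mem_of_transition (monkOp_boxGen_boxStaircase_mem x hr hrN) C hw hrN h hinc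
              fun w' h1 h2 h3 => ihm _ (by omega) w' rfl h1 h2
      exact fun w => inner _ w rfl
  refine key N hk le_rfl w hw fun i hi => ?_
  rw [hw i hi, hw (i + 1) (by omega)]
  omega

end Transition

/-! ### Restriction and factorization of generating functions -/

section Restriction

variable {R : Type*} [CommRing R]

theorem applyBoxes_apply_of_increasing (x : ℕ → R) {k : ℕ} (L : List (ℕ × ℕ))
    (hL : ∀ p ∈ L, k ≤ p.2) (f : Equiv.Perm ℕ → R) {w : Equiv.Perm ℕ}
    (hw : ∀ i, k ≤ i → w i < w (i + 1)) : applyBoxes x L f w = f w := by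
  induction L using List.reverseRecOn with
  | nil => rfl
  | append_singleton L p ih =>
    have := hw p.2 (hL p (by simp))
    rw [applyBoxes_concat, boxOp_apply, Pi.add_apply, Pi.smul_apply, descentOp_apply,
      if_neg (by omega), smul_zero, add_zero, ih fun q hq => hL q (by simp [hq])]

/-- Row a has only letters at least a, so the rows from k on act at positions where w has no
descent. -/
theorem boxGen_boxStaircase_of_increasing (x : ℕ → R) {k m N : ℕ} (hk : k ≤ m)
    {w : Equiv.Perm ℕ} (hw : ∀ i, k ≤ i → w i < w (i + 1)) :
    boxGen x (boxStaircase m N) w = boxGen x (boxStaircase k N) w := by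
  induction m, hk using Nat.le_induction with
  | base => rfl
  | succ m hm ih =>
    rw [← ih, boxGen, boxStaircase, applyBoxes_append]
    refine applyBoxes_apply_of_increasing x _ (fun p hp => ?_) _ hw
    have := mem_boxRow.1 hp
    omega

theorem boxGen_congr {x y : ℕ → R} {L : List (ℕ × ℕ)} (h : ∀ p ∈ L, x p.1 = y p.1) :
    boxGen x L = boxGen y L := by
  induction L using List.reverseRecOn with
  | nil => rfl
  | append_singleton L p ih =>
    rw [boxGen_concat, boxGen_concat, ih fun q hq => h q (by simp [hq]), boxOp, boxOp,
      h p (by simp)]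

theorem boxGen_append_of_weight_zero {x : ℕ → R} (L : List (ℕ × ℕ)) {L' : List (ℕ × ℕ)}
    (h : ∀ p ∈ L', x p.1 = 0) : boxGen x (L ++ L') = boxGen x L := by
  induction L' using List.reverseRecOn with
  | nil => simp
  | append_singleton L' p ih =>
    rw [← List.append_assoc, boxGen_concat, ih fun q hq => h q (by simp [hq]), boxOp_apply,
      h p (by simp), zero_smul, add_zero]

theorem boxGen_boxStaircase_of_weight_zero {x : ℕ → R} {k m : ℕ} (N : ℕ) (hk : k ≤ m)
    (h : ∀ a, k ≤ a → x a = 0) :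
    boxGen x (boxStaircase m N) = boxGen x (boxStaircase k N) := by
  induction m, hk using Nat.le_induction with
  | base => rfl
  | succ m hm ih =>
    rw [← ih, boxStaircase, boxGen_append_of_weight_zero]
    intro p hp
    have := mem_boxRow.1 hp
    exact h _ (by omega)

theorem map_boxGen {S : Type*} [CommRing S] (φ : R →+* S) (x : ℕ → R) (L : List (ℕ × ℕ))
    (w : Equiv.Perm ℕ) : φ (boxGen x L w) = boxGen (fun a => φ (x a)) L w := by
  induction L using List.reverseRecOn generalizing w with
  | nil =>
    simp only [boxGen, applyBoxes_nil, Pi.single_apply]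
    split_ifs <;> simp
  | append_singleton L p ih =>
    rw [boxGen_concat_apply, boxGen_concat_apply, map_add, ih, apply_ite φ, map_mul, ih, map_zero]

/-- The generating function at a direct sum of permutations is a product. -/
theorem boxGen_directSum (x : ℕ → R) (L : List (ℕ × ℕ)) {n : ℕ} {u v w : Equiv.Perm ℕ}
    (hu : ∀ i, n ≤ i → u i = i) (hwu : ∀ i, i < n → w i = u i) (hwv : ∀ i, w (n + i) = n + v i) :
    boxGen x L w = boxGen x (L.filter (fun p => p.2 < n)) u *
      boxGen x ((L.filter (fun p => n ≤ p.2)).map (fun p => (p.1, p.2 - n))) v := by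
  classical
  induction L using List.reverseRecOn generalizing u v w with
  | nil =>
    have h : w = 1 ↔ u = 1 ∧ v = 1 := by
      constructor
      · rintro rfl
        refine ⟨Equiv.ext fun i => ?_, Equiv.ext fun i => ?_⟩
        · rcases Nat.lt_or_ge i n with h | h
          · exact (hwu i h).symm
          · exact hu i h
        · have := hwv i
          simp only [Equiv.Perm.one_apply] at this ⊢
          omega
      · rintro ⟨rfl, rfl⟩
        refine Equiv.ext fun i => ?_
        rcases Nat.lt_or_ge i n with h | h
        · exact hwu i h
        · obtain ⟨j, rfl⟩ := Nat.exists_eq_add_of_le h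
          exact hwv j
    simp only [boxGen, List.filter_nil, List.map_nil, applyBoxes_nil, Pi.single_apply]
    by_cases hu1 : u = 1 <;> by_cases hv1 : v = 1 <;> simp [h, hu1, hv1]
  | append_singleton L p ih =>
    obtain ⟨a, i⟩ := p
    rw [boxGen_concat_apply, List.filter_append, List.filter_append, List.map_append]
    dsimp only
    rcases Nat.lt_or_ge i n with hi | hi
    · have h1 : [(a, i)].filter (fun p => p.2 < n) = [(a, i)] := by simp [hi]
      have h2 : [(a, i)].filter (fun p => n ≤ p.2) = [] := by simp [hi]
      rw [h1, h2, List.map_nil, List.append_nil, boxGen_concat_apply, ih hu hwu hwv, add_mul]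
      congr 1
      dsimp only
      rcases Nat.lt_or_ge (i + 1) n with hi' | hi'
      · rw [hwu i hi, hwu (i + 1) hi']
        split_ifs with hd
        · rw [ih (u := u * simpleTransposition i) (v := v), mul_assoc]
          · intro j hj
            rw [Equiv.Perm.mul_apply, simpleTransposition_apply_of_ne (by omega) (by omega),
              hu j hj]
          · intro j hj
            rw [Equiv.Perm.mul_apply, Equiv.Perm.mul_apply, hwu]
            simp only [simpleTransposition, Equiv.swap_apply_def]
            split_ifs <;> omega
          · intro j
            rw [Equiv.Perm.mul_apply, simpleTransposition_apply_of_ne (by omega) (by omega), hwv]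
        · rw [zero_mul]
      -- The letter n - 1 straddles the two blocks and is a descent of neither w nor u.
      · have h3 := lt_of_fixes hu hi
        have h4 := hwu i hi
        have h5 := hwv 0
        rw [show n + 0 = i + 1 by omega] at h5
        rw [hu (i + 1) hi', if_neg (by omega), if_neg (by omega), zero_mul]
    · have h1 : [(a, i)].filter (fun p => p.2 < n) = [] := by simp [hi]
      have h2 : [(a, i)].filter (fun p => n ≤ p.2) = [(a, i)] := by simp [hi]
      rw [h1, h2, List.append_nil, List.map_singleton, boxGen_concat_apply, ih hu hwu hwv, mul_add]
      congr 1
      dsimp only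
      obtain ⟨j, rfl⟩ := Nat.exists_eq_add_of_le hi
      rw [add_assoc, hwv, hwv, Nat.add_sub_cancel_left]
      by_cases hd : v (j + 1) < v j
      · rw [if_pos hd, if_pos (by omega), ih (u := u) (v := v * simpleTransposition j) hu,
          mul_left_comm]
        · intro c hc
          rw [Equiv.Perm.mul_apply, simpleTransposition_apply_of_ne (by omega) (by omega),
            hwu c hc]
        · intro c
          rw [Equiv.Perm.mul_apply, Equiv.Perm.mul_apply, ← hwv]
          congr 1
          simp only [simpleTransposition, Equiv.swap_apply_def]
          split_ifs <;> omega
      · rw [if_neg hd, if_neg (by omega), mul_zero]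

theorem boxRow_add (a : ℕ) {r n : ℕ} (M : ℕ) (h : r ≤ n) :
    boxRow a r (n + M) = (boxRow a 0 M).map (fun p => (p.1, n + p.2)) ++ boxRow a r n := by
  have h1 : n + M - r = (n - r) + M := by omega
  rw [boxRow, boxRow, boxRow, h1, ← List.range'_append_1, show r + (n - r) = n by omega]
  have h2 : List.range' n M = (List.range' 0 M).map (n + ·) := by
    rw [List.map_add_range', add_zero]
  rw [List.reverse_append, List.map_append, Nat.sub_zero, h2]
  simp [Function.comp_def]

theorem filter_boxStaircase_lt {k n : ℕ} (M : ℕ) (h : k ≤ n) :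
    (boxStaircase k (n + M)).filter (fun p => p.2 < n) = boxStaircase k n := by
  induction k with
  | zero => rfl
  | succ k ih =>
    rw [boxStaircase, boxStaircase, List.filter_append, ih (by omega),
      boxRow_add k M (show k ≤ n by omega), List.filter_append,
      List.filter_eq_nil_iff.2, List.nil_append, List.filter_eq_self.2]
    · intro p hp
      simpa using (mem_boxRow.1 hp).2.2
    · intro p hp
      obtain ⟨q, -, rfl⟩ := List.mem_map.1 hp
      simp

/-- Every row index is below k ≤ n, so a ≤ i holds for all letters i ≥ n and the staircase shape
disappears. -/
theorem filter_boxStaircase_ge {k n : ℕ} (M : ℕ) (h : k ≤ n) :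
    ((boxStaircase k (n + M)).filter (fun p => n ≤ p.2)).map (fun p => (p.1, p.2 - n)) =
      boxGrid k M := by
  induction k with
  | zero => rfl
  | succ k ih =>
    rw [boxStaircase, boxGrid, List.filter_append, List.map_append, ih (by omega),
      boxRow_add k M (show k ≤ n by omega), List.filter_append, List.filter_eq_self.2,
      List.filter_eq_nil_iff.2, List.append_nil, List.map_map]
    · simp [Function.comp_def]
    · intro p hp
      simpa using (mem_boxRow.1 hp).2.2
    · intro p hp
      obtain ⟨q, -, rfl⟩ := List.mem_map.1 hp
      simp

end Restriction

/-! ### Reduced words and subwords -/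

section ReducedWords

variable {R : Type*} [CommRing R]

theorem permLength_one : permLength 1 = 0 := by
  have := (valueInversions_wordPerm []).2
  rw [← permLength_eq] at this
  simpa [wordPerm] using this

theorem permLength_mul_lt {ρ : List ℕ} {i : ℕ}
    (h : wordPerm ρ i < wordPerm ρ (i + 1)) :
    permLength (wordPerm ρ * simpleTransposition i) = permLength (wordPerm ρ) + 1 := by
  rw [permLength_eq, permLength_eq, valueInversions_mul_lt _ _ h,
    Set.ncard_insert_of_notMem _ (valueInversions_wordPerm ρ).1]
  rintro ⟨-, h2⟩
  simp at h2

theorem permLength_mul_gt {ρ : List ℕ} {i : ℕ}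
    (h : wordPerm ρ (i + 1) < wordPerm ρ i) :
    permLength (wordPerm ρ * simpleTransposition i) ≤ permLength (wordPerm ρ) := by
  rw [permLength_eq, permLength_eq]
  exact Set.ncard_le_ncard (valueInversions_mul_gt _ _ h) (valueInversions_wordPerm ρ).1

theorem permLength_wordPerm_le (ρ : List ℕ) : permLength (wordPerm ρ) ≤ ρ.length := by
  rw [permLength_eq]
  exact (valueInversions_wordPerm ρ).2

theorem nil_mem_reducedWords {w : Equiv.Perm ℕ} : [] ∈ reducedWords w ↔ w = 1 := by
  constructor
  · rintro ⟨h, -⟩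
    exact h.symm.trans (by simp [wordPerm])
  · rintro rfl
    exact ⟨by simp [wordPerm], by simp [permLength_one]⟩

/-- An exchange adds exactly one inversion at an ascent and none at a descent, so comparing lengths
decides which occurred. The recursion is that of `boxGen_concat_apply`. -/
theorem concat_mem_reducedWords {ρ : List ℕ} {i : ℕ} {w : Equiv.Perm ℕ} :
    ρ ++ [i] ∈ reducedWords w ↔
      w (i + 1) < w i ∧ ρ ∈ reducedWords (w * simpleTransposition i) := by
  simp only [reducedWords, Set.mem_ofPred_eq, wordPerm_concat, List.length_append,
    List.length_singleton]
  have hww : wordPerm ρ * simpleTransposition i = w ↔ wordPerm ρ = w * simpleTransposition i := by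
    constructor
    · rintro rfl
      rw [mul_assoc, simpleTransposition_mul_self, mul_one]
    · intro h
      rw [h, mul_assoc, simpleTransposition_mul_self, mul_one]
  have hle := permLength_wordPerm_le ρ
  constructor
  · rintro ⟨h1, h2⟩
    rcases lt_or_gt_of_ne (show wordPerm ρ i ≠ wordPerm ρ (i + 1) by simp) with h | h
    · have h3 := permLength_mul_lt h
      refine ⟨?_, hww.1 h1, ?_⟩
      · rw [← h1, Equiv.Perm.mul_apply, Equiv.Perm.mul_apply, simpleTransposition_apply_left,
          simpleTransposition_apply_right]
        exact h
      · rw [← hww.1 h1]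
        rw [h1] at h3
        omega
    · have h3 := permLength_mul_gt h
      rw [h1] at h3
      omega
  · rintro ⟨h1, h2, h3⟩
    have h : wordPerm ρ i < wordPerm ρ (i + 1) := by
      rw [h2, Equiv.Perm.mul_apply, Equiv.Perm.mul_apply, simpleTransposition_apply_left,
          simpleTransposition_apply_right]
      exact h1
    refine ⟨hww.2 h2, ?_⟩
    rw [h3, ← h2, ← permLength_mul_lt h, hww.2 h2]

/-- Compatible sequences must jump only where the letters increase, whereas `BoxLT` also forbids
equal letters within a row; this closes the gap. -/
theorem reducedWords_isChain_ne {ρ : List ℕ} {w : Equiv.Perm ℕ} (h : ρ ∈ reducedWords w) :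
    ρ.IsChain (· ≠ ·) := by
  induction ρ using List.reverseRecOn generalizing w with
  | nil => exact List.isChain_nil
  | append_singleton ρ i ih =>
    obtain ⟨h1, h2⟩ := concat_mem_reducedWords.1 h
    rw [List.isChain_append]
    refine ⟨ih h2, List.isChain_singleton i, ?_⟩
    rintro a ha b hb rfl
    obtain rfl : i = a := by simpa using hb
    obtain ⟨ρ', rfl⟩ := List.getLast?_eq_some_iff.1 ha
    have h3 := (concat_mem_reducedWords.1 h2).1
    rw [Equiv.Perm.mul_apply, Equiv.Perm.mul_apply, simpleTransposition_apply_left,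
          simpleTransposition_apply_right] at h3
    omega

theorem letters_lt_of_fixes {ρ : List ℕ} {w : Equiv.Perm ℕ} {N : ℕ}
    (hw : ∀ i, N ≤ i → w i = i) (h : ρ ∈ reducedWords w) : ∀ i ∈ ρ, i < N := by
  obtain ⟨h1, h2⟩ := h
  refine (letters_lt N ρ (by rw [h1, ← permLength_eq, h2]) ?_).1
  rw [h1]
  rintro ⟨a, b⟩ ⟨h3, h4⟩
  by_contra hc
  simp only [not_lt] at h3 h4 hc
  have hfix : ∀ i, N ≤ i → w⁻¹ i = i := fun i hi => by
    rw [Equiv.Perm.inv_eq_iff_eq, hw i hi]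
  rw [hfix b hc] at h4
  have h5 : w (w⁻¹ a) = a := by simp
  rw [hw _ (by omega)] at h5
  omega

open Classical in
theorem boxGen_eq_sum_sublists (x : ℕ → R) (L : List (ℕ × ℕ)) (w : Equiv.Perm ℕ) :
    boxGen x L w = (L.sublists.map fun S => if S.map Prod.snd ∈ reducedWords w then
      (S.map fun p => x p.1).prod else 0).sum := by
  induction L using List.reverseRecOn generalizing w with
  | nil =>
    simp [boxGen, Pi.single_apply, nil_mem_reducedWords]
  | append_singleton L p ih =>
    rw [boxGen_concat_apply, List.sublists_concat, List.map_append, List.sum_append, ← ih w]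
    congr 1
    rw [List.map_map]
    split_ifs with h
    · rw [ih, ← List.sum_map_mul_left]
      congr 1
      refine List.map_congr_left fun S _ => ?_
      simp only [Function.comp_apply, List.map_append, List.map_singleton,
        concat_mem_reducedWords, List.prod_append, List.prod_singleton, h, true_and, ite_mul,
        zero_mul, mul_comm (x p.1)]
    · symm
      refine List.sum_eq_zero fun y hy => ?_
      obtain ⟨S, -, rfl⟩ := List.mem_map.1 hy
      simp [concat_mem_reducedWords, h]

theorem boxGen_eq_sum_words (x : ℕ → R) {L : List (ℕ × ℕ)} (hL : L.Nodup) (w : FinPerm) :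
    boxGen x L w = ∑ ρ ∈ reducedWordFinset w,
      ∑ S ∈ L.sublists.toFinset with S.map Prod.snd = ρ, (S.map fun p => x p.1).prod := by
  classical
  rw [boxGen_eq_sum_sublists, ← List.sum_toFinset _ (List.nodup_sublists.2 hL),
    ← Finset.sum_filter]
  have hmem : ∀ ρ, ρ ∈ reducedWordFinset w ↔ ρ ∈ reducedWords w := fun ρ => by
    simp [reducedWordFinset]
  rw [← Finset.sum_fiberwise_of_maps_to (t := reducedWordFinset w) (g := List.map Prod.snd)
    fun S hS => (hmem _).2 (Finset.mem_filter.1 hS).2]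
  refine Finset.sum_congr rfl fun ρ hρ => ?_
  congr 1
  ext S
  simp only [Finset.mem_filter]
  constructor
  · rintro ⟨⟨h1, -⟩, h2⟩; exact ⟨h1, h2⟩
  · rintro ⟨h1, rfl⟩; exact ⟨⟨h1, (hmem _).1 hρ⟩, rfl⟩

/-- The reading order of boxes: rows from top to bottom, each row from right to left. -/
def BoxLT (p q : ℕ × ℕ) : Prop := p.1 < q.1 ∨ p.1 = q.1 ∧ q.2 < p.2

instance : Trans BoxLT BoxLT BoxLT where
  trans := by
    intro a b c h1 h2
    unfold BoxLT at *
    omega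

theorem pairwise_boxRow (a r N : ℕ) : (boxRow a r N).Pairwise BoxLT := by
  rw [boxRow, List.pairwise_map, List.pairwise_reverse]
  exact (List.pairwise_lt_range' (s := r) (n := N - r)).imp fun h => Or.inr ⟨rfl, h⟩

theorem pairwise_boxStaircase (k N : ℕ) : (boxStaircase k N).Pairwise BoxLT := by
  induction k with
  | zero => exact List.Pairwise.nil
  | succ k ih =>
    refine List.pairwise_append.2 ⟨ih, pairwise_boxRow k k N, fun p hp q hq => Or.inl ?_⟩
    have := (mem_boxStaircase.1 hp).1
    have := (mem_boxRow.1 hq).1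
    omega

theorem pairwise_boxGrid (k N : ℕ) : (boxGrid k N).Pairwise BoxLT := by
  induction k with
  | zero => exact List.Pairwise.nil
  | succ k ih =>
    refine List.pairwise_append.2 ⟨ih, pairwise_boxRow k 0 N, fun p hp q hq => Or.inl ?_⟩
    have := (mem_boxGrid.1 hp).1
    have := (mem_boxRow.1 hq).1
    omega

theorem nodup_of_pairwise_boxLT {L : List (ℕ × ℕ)} (h : L.Pairwise BoxLT) : L.Nodup :=
  h.imp fun {a b} hab => by
    rintro rfl
    unfold BoxLT at hab
    omega

theorem sublist_iff_of_pairwise_boxLT {L S : List (ℕ × ℕ)} (hL : L.Pairwise BoxLT) :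
    S.Sublist L ↔ S.IsChain BoxLT ∧ ∀ p ∈ S, p ∈ L := by
  rw [List.isChain_iff_pairwise]
  have : Std.Antisymm BoxLT := ⟨fun a b h1 h2 => by unfold BoxLT at *; omega⟩
  exact ⟨fun h => ⟨hL.sublist h, fun p hp => h.subset hp⟩, fun h =>
    List.sublist_of_subperm_of_pairwise ((nodup_of_pairwise_boxLT h.1).subperm h.2) h.1 hL⟩

/-- Pair α_j with ρ_j: the bound α_j ≤ ρ_j puts the box in the staircase, and the monotonicity
conditions say that the boxes form a `BoxLT` chain. -/
theorem sum_compatibleSequences (x : ℕ → R) {ρ : List ℕ} {N : ℕ} (hρ : ρ.IsChain (· ≠ ·))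
    (hN : ∀ i ∈ ρ, i < N) :
    ∑ α ∈ compatibleSequences ρ, ∏ j, x (α j) =
      ∑ S ∈ (boxStaircase N N).sublists.toFinset with S.map Prod.snd = ρ,
        (S.map fun p => x p.1).prod := by
  classical
  have hmem : ∀ S : List (ℕ × ℕ), S ∈ (boxStaircase N N).sublists.toFinset ↔
      S.IsChain BoxLT ∧ ∀ p ∈ S, p.1 ≤ p.2 ∧ p.2 < N := by
    intro S
    rw [List.mem_toFinset, List.mem_sublists, sublist_iff_of_pairwise_boxLT
      (pairwise_boxStaircase N N)]
    refine and_congr_right fun _ => forall₂_congr fun p _ => ?_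
    rw [mem_boxStaircase]
    omega
  have hcomp : ∀ α : Fin ρ.length → ℕ, α ∈ compatibleSequences ρ ↔
      (∀ j, α j ≤ ρ.get j) ∧ Monotone α ∧
      ∀ i j : Fin ρ.length, (j : ℕ) = (i : ℕ) + 1 → ρ.get i < ρ.get j → α i < α j := by
    intro α
    simp [compatibleSequences]
  refine Finset.sum_bij (fun α _ => List.ofFn fun j => (α j, ρ.get j)) ?_ ?_ ?_ ?_
  · intro α hα
    obtain ⟨h1, h2, h3⟩ := (hcomp α).1 hα
    rw [Finset.mem_filter, hmem, List.isChain_ofFn]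
    refine ⟨⟨fun i hi => ?_, ?_⟩, ?_⟩
    · have h4 := h2 (show (⟨i, by omega⟩ : Fin ρ.length) ≤ ⟨i + 1, hi⟩ by simp)
      have h5 := h3 ⟨i, by omega⟩ ⟨i + 1, hi⟩ rfl
      have h6 := List.isChain_iff_getElem.1 hρ i hi
      simp only [List.get_eq_getElem] at h5 ⊢
      unfold BoxLT
      dsimp only
      omega
    · intro p hp
      obtain ⟨j, rfl⟩ := (List.mem_ofFn' _ _).1 hp
      exact ⟨h1 j, hN _ (List.get_mem _ _)⟩
    · rw [List.map_ofFn]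
      exact List.ofFn_get ρ
  · intro α _ β _ h
    funext j
    exact (Prod.mk.inj (congrFun (List.ofFn_injective h) j)).1
  · intro S hS
    obtain ⟨h1, rfl⟩ := Finset.mem_filter.1 hS
    obtain ⟨h1, h2⟩ := (hmem S).1 h1
    have h3 := List.isChain_iff_pairwise.1 h1
    have hl : (S.map Prod.snd).length = S.length := List.length_map _
    refine ⟨fun j => (S.get (j.cast hl)).1, (hcomp _).2 ⟨fun j => ?_, fun i j hij => ?_, ?_⟩, ?_⟩
    · simpa using (h2 _ (List.get_mem S (j.cast hl))).1
    · rcases hij.eq_or_lt with rfl | hij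
      · exact le_rfl
      · have := List.pairwise_iff_get.1 h3 (i.cast hl) (j.cast hl) hij
        unfold BoxLT at this
        dsimp only
        omega
    · intro i j hij hlt
      have := List.pairwise_iff_get.1 h3 (i.cast hl) (j.cast hl) (by
        rw [Fin.lt_def]; simp [hij])
      unfold BoxLT at this
      simp only [List.get_eq_getElem, List.getElem_map] at hlt this ⊢
      simp only [Fin.val_cast] at this ⊢
      omega
    · refine List.ext_getElem (by simp) fun i hi hi' => ?_
      simp
  · intro α _
    rw [List.map_ofFn, List.prod_ofFn]
    rfl

/-- The Schubert polynomial as a generating function of boxes. -/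
theorem schubert_eq_boxGen {w : FinPerm} {N : ℕ} (hw : ∀ i, N ≤ i → (w : Equiv.Perm ℕ) i = i) :
    schubert w = boxGen MvPolynomial.X (boxStaircase N N) w := by
  rw [boxGen_eq_sum_words _ (nodup_of_pairwise_boxLT (pairwise_boxStaircase N N)), schubert]
  refine Finset.sum_congr rfl fun ρ hρ => ?_
  have h : ρ ∈ reducedWords w := by simpa [reducedWordFinset] using hρ
  exact sum_compatibleSequences _ (reducedWords_isChain_ne h) (letters_lt_of_fixes hw h)

end ReducedWords

/-! ### Fundamental quasisymmetric polynomials -/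

section Stanley

/-- The runs of b :: l, with a joined to the first run or placed before it, still satisfy the
conditions of `List.splitBy_flatten`, which determine the splitting. -/
theorem splitBy_cons_cons {α : Type*} (r : α → α → Bool) (a b : α) (l : List α) :
    ∃ h t, List.splitBy r (b :: l) = (b :: h) :: t ∧
      List.splitBy r (a :: b :: l) = if r a b then (a :: b :: h) :: t else [a] :: (b :: h) :: t := by
  have hflat := List.flatten_splitBy r (b :: l)
  have hnil := List.nil_notMem_splitBy r (b :: l)
  have hchain := fun m (hm : m ∈ List.splitBy r (b :: l)) => List.isChain_of_mem_splitBy hm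
  have hlast := List.isChain_getLast_head_splitBy r (b :: l)
  match hs : List.splitBy r (b :: l) with
  | [] => exact absurd (List.splitBy_eq_nil.1 hs) (by simp)
  | [] :: t => simp [hs] at hnil
  | (c :: h) :: t =>
    rw [hs] at hflat hnil hchain hlast
    simp only [List.flatten_cons, List.cons_append, List.cons.injEq] at hflat
    obtain ⟨rfl, hl⟩ := hflat
    refine ⟨h, t, rfl, ?_⟩
    split_ifs with hr
    · have e : a :: c :: l = ((a :: c :: h) :: t).flatten := by simp [hl]
      rw [e, List.splitBy_flatten]
      · simpa using hnil
      · intro m hm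
        rcases List.mem_cons.1 hm with rfl | hm
        · exact List.isChain_cons_cons.2 ⟨hr, hchain _ (by simp)⟩
        · exact hchain _ (by simp [hm])
      · cases t with
        | nil => exact List.isChain_singleton _
        | cons m t =>
          rw [List.isChain_cons_cons] at hlast ⊢
          refine ⟨?_, hlast.2⟩
          obtain ⟨_, hb, h3⟩ := hlast.1
          exact ⟨by simp, hb, by simpa using h3⟩
    · have e : a :: c :: l = ([a] :: (c :: h) :: t).flatten := by simp [hl]
      rw [e, List.splitBy_flatten]
      · simpa using hnil
      · intro m hm
        rcases List.mem_cons.1 hm with rfl | hm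
        · exact List.isChain_singleton _
        · exact hchain _ hm
      · rw [List.isChain_cons_cons]
        exact ⟨⟨by simp, by simp, by simpa using hr⟩, hlast⟩

/-- The lengths of the maximal runs of a list whose consecutive terms are related by `r`. -/
def runLengths {α : Type*} (r : α → α → Bool) (l : List α) : List ℕ :=
  (l.splitBy r).map List.length

theorem runLengths_cons_cons {α : Type*} (r : α → α → Bool) (a b : α) (l : List α) :
    ∃ d s, runLengths r (b :: l) = (d + 1) :: s ∧
      runLengths r (a :: b :: l) = if r a b then (d + 2) :: s else 1 :: (d + 1) :: s := by
  obtain ⟨h, t, h1, h2⟩ := splitBy_cons_cons r a b l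
  refine ⟨h.length, t.map List.length, by simp [runLengths, h1], ?_⟩
  rw [runLengths, h2]
  split_ifs <;> simp

theorem zero_notMem_runLengths {α : Type*} (r : α → α → Bool) (l : List α) :
    0 ∉ runLengths r l := by
  simp [runLengths, List.length_eq_zero_iff]

theorem sum_runLengths {α : Type*} (r : α → α → Bool) (l : List α) :
    (runLengths r l).sum = l.length := by
  rw [runLengths, ← List.length_flatten, List.flatten_splitBy]

/-- This and the next three lemmas remove one unit from the heads of both compositions, as needed
when the first letter of a word is dropped. -/
theorem refines_succ_cons {h d : ℕ} {t s : List ℕ} :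
    Refines ((h + 1) :: t) ((d + 2) :: s) ↔ Refines (h :: t) ((d + 1) :: s) := by
  constructor
  · rintro ⟨L, h1, h2⟩
    match L, h2 with
    | [] :: L, h2 => simp at h2
    | (a :: l) :: L, h2 =>
      simp only [List.flatten_cons, List.cons_append, List.cons.injEq] at h1
      simp only [List.map_cons, List.sum_cons, List.cons.injEq] at h2
      exact ⟨(h :: l) :: L, by simp [h1.2], by simp [h2.2]; omega⟩
  · rintro ⟨L, h1, h2⟩
    match L, h2 with
    | [] :: L, h2 => simp at h2
    | (a :: l) :: L, h2 =>
      simp only [List.flatten_cons, List.cons_append, List.cons.injEq] at h1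
      simp only [List.map_cons, List.sum_cons, List.cons.injEq] at h2
      exact ⟨((h + 1) :: l) :: L, by simp [h1.2], by simp [h2.2]; omega⟩

theorem refines_one_cons {d : ℕ} {β s : List ℕ} :
    Refines (1 :: β) ((d + 1) :: s) ↔ Refines β (d :: s) := by
  constructor
  · rintro ⟨L, h1, h2⟩
    match L, h2 with
    | [] :: L, h2 => simp at h2
    | (a :: l) :: L, h2 =>
      simp only [List.flatten_cons, List.cons_append, List.cons.injEq] at h1
      simp only [List.map_cons, List.sum_cons, List.cons.injEq] at h2
      exact ⟨l :: L, by simp [h1.2], by simp [h2.2]; omega⟩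
  · rintro ⟨L, h1, h2⟩
    match L, h2 with
    | l :: L, h2 =>
      simp only [List.map_cons, List.cons.injEq] at h2
      exact ⟨(1 :: l) :: L, by simpa using h1, by simp [h2.2]; omega⟩

/-- Without zeros in β, only the empty block can have sum 0. -/
theorem refines_zero_cons {β s : List ℕ} (hβ : 0 ∉ β) : Refines β (0 :: s) ↔ Refines β s := by
  constructor
  · rintro ⟨L, h1, h2⟩
    match L, h2 with
    | [] :: L, h2 => exact ⟨L, by simpa using h1, by simpa using h2⟩
    | (a :: l) :: L, h2 =>
      simp only [List.map_cons, List.sum_cons, List.cons.injEq, Nat.add_eq_zero_iff] at h2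
      exact absurd (by simp [← h1, h2.1.1]) hβ
  · rintro ⟨L, h1, h2⟩
    exact ⟨[] :: L, by simpa using h1, by simpa using h2⟩

theorem not_refines_one {h : ℕ} {t s : List ℕ} : ¬ Refines ((h + 2) :: t) (1 :: s) := by
  rintro ⟨L, h1, h2⟩
  match L, h2 with
  | [] :: L, h2 => simp at h2
  | (a :: l) :: L, h2 =>
    simp only [List.flatten_cons, List.cons_append, List.cons.injEq] at h1
    simp only [List.map_cons, List.sum_cons, List.cons.injEq] at h2
    omega

/-- Equal neighbours in α lengthen a part of the finer composition; a descent of ρ lengthens a part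
of the coarser one. The only forbidden case is equality without descent, where a part at least 2
would have to fit into a part 1. -/
theorem isChain_zip_iff_refines {α ρ : List ℕ} (hα : α.Pairwise (· ≤ ·))
    (hl : α.length = ρ.length) :
    (α.zip ρ).IsChain BoxLT ↔
      Refines (runLengths (fun a b => decide (a = b)) α) (descentComposition ρ) := by
  induction α generalizing ρ with
  | nil =>
    obtain rfl : ρ = [] := List.length_eq_zero_iff.1 hl.symm
    simp only [List.zip_nil_left, List.isChain_nil, true_iff]
    exact ⟨[], rfl, rfl⟩
  | cons a α ih =>
    match α, ρ, hl with
    | [], [r], _ =>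
      simp only [List.zip_cons_cons, List.zip_nil_left, List.isChain_singleton, true_iff]
      exact ⟨[[1]], rfl, rfl⟩
    | a' :: α, r :: r' :: ρ, hl =>
      obtain ⟨d, s, h1, h2⟩ := runLengths_cons_cons (fun a b => decide (b < a)) r r' ρ
      obtain ⟨e, t, h3, h4⟩ := runLengths_cons_cons (fun a b => decide (a = b)) a a' α
      have ih' := ih hα.tail (ρ := r' :: ρ) (by simpa using hl)
      have haa : a ≤ a' := List.rel_of_pairwise_cons hα (by simp)
      have hD : ∀ l, descentComposition l = runLengths (fun a b => decide (b < a)) l :=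
        fun _ => rfl
      have h0 : 0 ∉ (e + 1) :: t := h3 ▸ zero_notMem_runLengths _ _
      rw [hD, h1, h3] at ih'
      rw [hD, h2, h4, List.zip_cons_cons, List.zip_cons_cons, List.isChain_cons_cons,
        ← List.zip_cons_cons, ih']
      simp only [decide_eq_true_eq]
      by_cases hr : r' < r
      · rw [if_pos hr]
        by_cases ha : a = a'
        · rw [if_pos ha, refines_succ_cons]
          simp [BoxLT, ha, hr]
        · rw [if_neg ha, refines_one_cons]
          simp [BoxLT, show a < a' by omega]
      · rw [if_neg hr]
        by_cases ha : a = a'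
        · rw [if_pos ha]
          simp [BoxLT, ha, hr, not_refines_one]
        · rw [if_neg ha, refines_one_cons, refines_zero_cons h0]
          simp [BoxLT, show a < a' by omega]

/-- The weakly increasing list in which `i` occurs `b i` times. -/
def contentList {k : ℕ} (b : Fin k → ℕ) : List ℕ :=
  (List.ofFn fun i => List.replicate (b i) (i : ℕ)).flatten

theorem pairwise_blocks {k : ℕ} (b : Fin k → ℕ) :
    (List.ofFn fun i => List.replicate (b i) (i : ℕ)).Pairwise
      (fun l l' => ∀ x ∈ l, ∀ y ∈ l', x < y) := by
  rw [List.pairwise_ofFn]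
  intro i j hij x hx y hy
  rw [List.eq_of_mem_replicate hx, List.eq_of_mem_replicate hy]
  exact hij

theorem pairwise_contentList {k : ℕ} (b : Fin k → ℕ) : (contentList b).Pairwise (· ≤ ·) := by
  rw [contentList, List.pairwise_flatten]
  refine ⟨fun l hl => ?_, (pairwise_blocks b).imp fun h x hx y hy => (h x hx y hy).le⟩
  obtain ⟨i, rfl⟩ := (List.mem_ofFn' _ _).1 hl
  exact List.pairwise_replicate.2 (Or.inr le_rfl)

theorem runLengths_contentList {k : ℕ} (b : Fin k → ℕ) :
    runLengths (fun a b => decide (a = b)) (contentList b) = flat b := by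
  set L := (List.ofFn fun i => List.replicate (b i) (i : ℕ)) with hL
  have h1 : contentList b = (L.filter (fun l => l.length ≠ 0)).flatten := by
    rw [contentList, ← hL]
    clear_value L
    clear hL
    induction L with
    | nil => rfl
    | cons l L ih =>
      rw [List.filter_cons]
      split_ifs with h
      · simp [ih]
      · have : l = [] := by simpa using h
        simp [ih, this]
  have hne : ∀ l ∈ L.filter (fun l => l.length ≠ 0), l ≠ [] := by
    rintro l hl rfl
    simp at hl
  rw [h1, runLengths, List.splitBy_flatten]
  · rw [flat, show List.ofFn b = L.map List.length by rw [hL, List.map_ofFn]; simp [Function.comp_def],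
      List.filter_map]
    rfl
  · exact fun h => hne _ h rfl
  · intro m hm
    obtain ⟨i, rfl⟩ := (List.mem_ofFn' _ _).1 (List.mem_of_mem_filter hm)
    refine List.Pairwise.isChain (List.pairwise_replicate.2 (Or.inr ?_))
    simp
  · refine List.Pairwise.isChain (((pairwise_blocks b).filter _).imp_of_mem ?_)
    intro l l' hl hl' h
    refine ⟨hne l hl, hne l' hl', ?_⟩
    have := h _ (List.getLast_mem (hne l hl)) _ (List.head_mem (hne l' hl'))
    simpa using this.ne

theorem count_contentList {k : ℕ} (b : Fin k → ℕ) (i : Fin k) :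
    (contentList b).count (i : ℕ) = b i := by
  rw [contentList, List.count_flatten, List.map_ofFn, List.sum_ofFn,
    Finset.sum_eq_single i]
  · simp
  · intro j _ hj
    have : (j : ℕ) ≠ i := fun h => hj (Fin.ext h)
    simp [List.count_replicate, this]
  · simp

theorem lt_of_mem_contentList {k : ℕ} {b : Fin k → ℕ} {a : ℕ} (ha : a ∈ contentList b) :
    a < k := by
  obtain ⟨l, hl, hal⟩ := List.mem_flatten.1 ha
  obtain ⟨i, rfl⟩ := (List.mem_ofFn' _ _).1 hl
  rw [List.eq_of_mem_replicate hal]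
  exact i.2

theorem length_contentList {k : ℕ} (b : Fin k → ℕ) : (contentList b).length = ∑ i, b i := by
  rw [contentList, List.length_flatten, List.map_ofFn, List.sum_ofFn]
  simp

theorem prod_map_contentList {k : ℕ} {R : Type*} [CommMonoid R] (x : ℕ → R) (b : Fin k → ℕ) :
    ((contentList b).map x).prod = ∏ i : Fin k, x i ^ b i := by
  rw [contentList, List.map_flatten, List.map_ofFn, List.prod_flatten, List.map_ofFn,
    List.prod_ofFn]
  simp

theorem contentList_count {k : ℕ} {α : List ℕ} (hα : α.Pairwise (· ≤ ·)) (hk : ∀ a ∈ α, a < k) :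
    contentList (fun i : Fin k => α.count (i : ℕ)) = α := by
  refine List.Perm.eq_of_pairwise' (r := (· ≤ ·)) (pairwise_contentList _) hα ?_
  rw [List.perm_iff_count]
  intro a
  by_cases ha : a < k
  · exact count_contentList _ ⟨a, ha⟩
  · rw [List.count_eq_zero_of_not_mem fun h => ha (lt_of_mem_contentList h),
      List.count_eq_zero_of_not_mem fun h => ha (hk a h)]

/-- An exponent vector b corresponds to the weakly increasing list of row indices with content b,
zipped with ρ. -/
theorem fundamental_eq_sum {k M : ℕ} {ρ : List ℕ} (hM : ∀ i ∈ ρ, i < M) :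
    fundamental k (descentComposition ρ) =
      ∑ S ∈ (boxGrid k M).sublists.toFinset with S.map Prod.snd = ρ,
        (S.map fun p => (MvPolynomial.X p.1 : MvPolynomial ℕ ℤ)).prod := by
  classical
  have hmem : ∀ S : List (ℕ × ℕ), S ∈ (boxGrid k M).sublists.toFinset ↔
      S.IsChain BoxLT ∧ ∀ p ∈ S, p.1 < k ∧ p.2 < M := by
    intro S
    rw [List.mem_toFinset, List.mem_sublists, sublist_iff_of_pairwise_boxLT (pairwise_boxGrid k M)]
    exact and_congr_right fun _ => forall₂_congr fun p _ => mem_boxGrid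
  have hsum : (descentComposition ρ).sum = ρ.length := sum_runLengths _ ρ
  have hzip : ∀ S : List (ℕ × ℕ), (S.map Prod.fst).zip (S.map Prod.snd) = S := fun S => by
    rw [List.zip_map', List.map_id']
  have hsorted : ∀ S : List (ℕ × ℕ), S.IsChain BoxLT → (S.map Prod.fst).Pairwise (· ≤ ·) := by
    intro S hS
    rw [List.pairwise_map]
    refine (List.isChain_iff_pairwise.1 hS).imp fun h => ?_
    unfold BoxLT at h
    omega
  have hcontent : ∀ S ∈ (boxGrid k M).sublists.toFinset,
      contentList (fun i : Fin k => (S.map Prod.fst).count (i : ℕ)) = S.map Prod.fst := by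
    intro S hS
    obtain ⟨h1, h2⟩ := (hmem S).1 hS
    refine contentList_count (hsorted S h1) fun a ha => ?_
    obtain ⟨p, hp, rfl⟩ := List.mem_map.1 ha
    exact (h2 p hp).1
  have hlen : ∀ b ∈ (Finset.finAntidiagonal k (descentComposition ρ).sum).filter
      (fun b => Refines (flat b) (descentComposition ρ)),
      (contentList b).length = ρ.length := by
    intro b hb
    rw [length_contentList, ← hsum]
    exact Finset.mem_finAntidiagonal.1 (Finset.mem_filter.1 hb).1
  rw [fundamental]
  refine Finset.sum_bij' (fun b _ => (contentList b).zip ρ)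
    (fun S _ i => (S.map Prod.fst).count (i : ℕ)) ?_ ?_ ?_ ?_ ?_
  · intro b hb
    have hl := hlen b hb
    rw [Finset.mem_filter, hmem, isChain_zip_iff_refines (pairwise_contentList b) hl,
      runLengths_contentList]
    refine ⟨⟨(Finset.mem_filter.1 hb).2, fun p hp => ?_⟩, List.map_snd_zip hl.ge⟩
    have := List.of_mem_zip (a := p.1) (b := p.2) hp
    exact ⟨lt_of_mem_contentList this.1, hM _ this.2⟩
  · intro S hS
    obtain ⟨h1, h2⟩ := Finset.mem_filter.1 hS
    have h3 := ((hmem S).1 h1).1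
    have h4 := hcontent S h1
    rw [Finset.mem_filter, Finset.mem_finAntidiagonal, ← length_contentList,
      ← runLengths_contentList, h4, ← isChain_zip_iff_refines (hsorted S h3) (by simp [← h2]),
      ← h2, hzip]
    exact ⟨by rw [h2, hsum, ← h2]; simp, h3⟩
  · intro b hb
    funext i
    rw [List.map_fst_zip (hlen b hb).le, count_contentList]
  · intro S hS
    obtain ⟨h1, h2⟩ := Finset.mem_filter.1 hS
    rw [hcontent S h1, ← h2, hzip]
  · intro b hb
    rw [← prod_map_contentList, ← List.map_fst_zip (hlen b hb).le, List.map_map,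
      List.map_fst_zip (hlen b hb).le]
    rfl

/-- The Stanley symmetric polynomial as a generating function of boxes. -/
theorem stanley_eq_boxGen (k : ℕ) {v : FinPerm} {M : ℕ}
    (hv : ∀ i, M ≤ i → (v : Equiv.Perm ℕ) i = i) :
    stanley k v = boxGen MvPolynomial.X (boxGrid k M) v := by
  rw [boxGen_eq_sum_words _ (nodup_of_pairwise_boxLT (pairwise_boxGrid k M)), stanley]
  refine Finset.sum_congr rfl fun ρ hρ => ?_
  have h : ρ ∈ reducedWords v := by simpa [reducedWordFinset] using hρ
  exact fundamental_eq_sum (letters_lt_of_fixes hv h)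

end Stanley

/-! ### Schubert positivity -/

theorem exists_fixes (w : FinPerm) :
    ∃ N, ∀ i, N ≤ i → (w : Equiv.Perm ℕ) i = i := by
  obtain ⟨M, hM⟩ := Set.Finite.bddAbove (show {i | (w : Equiv.Perm ℕ) i ≠ i}.Finite from w.2)
  refine ⟨M + 1, fun i hi => ?_⟩
  by_contra h
  have := hM h
  omega

theorem mem_finPerm_of_fixes {w : Equiv.Perm ℕ} {N : ℕ} (hw : ∀ i, N ≤ i → w i = i) :
    w ∈ FinPerm :=
  (Set.finite_lt_nat N).subset fun i hi => by
    by_contra h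
    exact hi (hw i (not_lt.1 h))

/-- The direct sum of a permutation of `{0, …, n - 1}` and a permutation of `ℕ`. -/
theorem exists_directSum {n : ℕ} {u v : Equiv.Perm ℕ} (hu : ∀ i, n ≤ i → u i = i) :
    ∃ w : Equiv.Perm ℕ, (∀ i, i < n → w i = u i) ∧ ∀ i, w (n + i) = n + v i := by
  let shift (p : Equiv.Perm ℕ) (i : ℕ) : ℕ := if i < n then i else n + p (i - n)
  have hshift : ∀ p q : Equiv.Perm ℕ, (∀ i, q (p i) = i) → ∀ i, shift q (shift p i) = i := by
    intro p q h i
    dsimp only [shift]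
    split_ifs <;> first | omega | skip
    rw [Nat.add_sub_cancel_left, h]
    omega
  let w : Equiv.Perm ℕ := ⟨shift v, shift v⁻¹, hshift _ _ (by simp), hshift _ _ (by simp)⟩
  have hw : ∀ i, w i = shift v i := fun _ => rfl
  refine ⟨u * w, fun i hi => ?_, fun i => ?_⟩
  · rw [Equiv.Perm.mul_apply, hw]
    simp [shift, hi]
  · rw [Equiv.Perm.mul_apply, hw]
    simp only [shift, Nat.add_sub_cancel_left]
    rw [if_neg (by omega), hu _ (by omega)]

/-- Substituting 0 for the variables from k on leaves the polynomial unchanged, as none of them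
occurs, and kills the rows from k on. -/
theorem schubert_eq_boxGen_of_vars {u : FinPerm} {k n : ℕ} (hk : k ≤ n)
    (hu : ∀ i, n ≤ i → (u : Equiv.Perm ℕ) i = i) (hvars : (schubert u).vars ⊆ Finset.range k) :
    schubert u = boxGen MvPolynomial.X (boxStaircase k n) u := by
  let y : ℕ → MvPolynomial ℕ ℤ := fun a => if a < k then MvPolynomial.X a else 0
  have h1 : MvPolynomial.aeval y (schubert u) = schubert u := by
    conv_rhs => rw [← MvPolynomial.aeval_X_left_apply (schubert u)]
    refine MvPolynomial.eval₂Hom_congr' rfl (fun i hi _ => ?_) rfl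
    exact if_pos (Finset.mem_range.1 (hvars hi))
  rw [← h1, schubert_eq_boxGen hu]
  refine (map_boxGen (MvPolynomial.aeval y : MvPolynomial ℕ ℤ →ₐ[ℤ] _).toRingHom _ _ _).trans ?_
  have h2 : (fun a => (MvPolynomial.aeval y : MvPolynomial ℕ ℤ →ₐ[ℤ] _).toRingHom
      (MvPolynomial.X a)) = y := by
    funext a
    simp
  rw [h2, boxGen_boxStaircase_of_weight_zero n hk fun a ha => if_neg (not_lt.2 ha)]
  refine congrFun (boxGen_congr fun p hp => if_pos (mem_boxStaircase.1 hp).1) _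

theorem boxGen_boxStaircase_mem_closure {k N : ℕ} (hk : k ≤ N) {w : Equiv.Perm ℕ}
    (hw : ∀ i, N ≤ i → w i = i) :
    boxGen MvPolynomial.X (boxStaircase k N) w ∈
      AddSubmonoid.closure (Set.range schubert) := by
  refine boxGen_boxStaircase_mem _ hk _ (fun w hw hinc => ?_) hw
  refine AddSubmonoid.subset_closure ⟨⟨w, mem_finPerm_of_fixes hw⟩, ?_⟩
  rw [schubert_eq_boxGen (w := ⟨w, mem_finPerm_of_fixes hw⟩) hw]
  exact boxGen_boxStaircase_of_increasing _ hk hinc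

theorem exists_finsupp_of_mem_closure {p : MvPolynomial ℕ ℤ}
    (hp : p ∈ AddSubmonoid.closure (Set.range schubert)) :
    ∃ c : FinPerm →₀ ℕ, p = c.sum fun w n => n • schubert w := by
  classical
  induction hp using AddSubmonoid.closure_induction with
  | mem p hp =>
    obtain ⟨w, rfl⟩ := hp
    exact ⟨Finsupp.single w 1, by simp⟩
  | zero => exact ⟨0, by simp⟩
  | add p q _ _ hp hq =>
    obtain ⟨c, rfl⟩ := hp
    obtain ⟨d, rfl⟩ := hq
    refine ⟨c + d, ?_⟩
    rw [Finsupp.sum_add_index' (by simp) (by intros; rw [add_smul])]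

theorem mainTheorem6 (j k : ℕ) (hjk : j ≤ k) (u v : FinPerm)
    (hu : (schubert u).vars ⊆ Finset.range j) :
    ∃ c : FinPerm →₀ ℕ, schubert u * stanley k v = c.sum fun w n => n • schubert w := by
  obtain ⟨n₀, hn₀⟩ := exists_fixes u
  obtain ⟨M, hM⟩ := exists_fixes v
  -- The block of u is enlarged to size at least k so that the boxes with letters from n on form a
  -- full grid.
  obtain ⟨n, hkn, hn⟩ : ∃ n, k ≤ n ∧ ∀ i, n ≤ i → (u : Equiv.Perm ℕ) i = i :=
    ⟨max n₀ k, le_max_right _ _, fun i hi => hn₀ i ((le_max_left _ _).trans hi)⟩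
  obtain ⟨w, hwu, hwv⟩ := exists_directSum (v := v) hn
  have hw : ∀ i, n + M ≤ i → w i = i := by
    intro i hi
    obtain ⟨c, rfl⟩ := Nat.exists_eq_add_of_le (show n ≤ i by omega)
    rw [hwv, hM c (by omega)]
  refine exists_finsupp_of_mem_closure ?_
  rw [schubert_eq_boxGen_of_vars hkn hn (hu.trans (Finset.range_subset_range.2 hjk)),
    stanley_eq_boxGen k hM, ← filter_boxStaircase_lt M hkn, ← filter_boxStaircase_ge M hkn,
    ← boxGen_directSum _ _ hn hwu hwv]
  exact boxGen_boxStaircase_mem_closure (by omega) hw
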